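/- An algorithm taking $n$ samples is a Markov kernel $M$ from $\mathbb{R}^n$ to $\mathbb{R}$. It is $(\varepsilon,\delta)$-DP if $\Pr[M(x)\in S]\le e^{\varepsilon}\Pr[M(x')\in S]+\delta$ for all datasets $x,x'\in\mathbb{R}^n$ that differ in exactly one entry and all measurable $S\subseteq\mathbb{R}$. It is $\rho$-zCDP if $D_a(M(x)\,\|\,M(x'))\le\rho a$ for all such $x,x'$ and all $a\in(1,\infty)$, where $D_a(P\|Q)=\frac{1}{a-1}\log\int(\mathrm{d}P/\mathrm{d}Q)^a\,\mathrm{d}Q$ is the Rényi divergence, equal to $\infty$ if $P\not\ll Q$. Theorem. For every $\beta_0<1$ there is a constant $C>0$, depending only on $\beta_0$, such that for all real $k\ge 2$, $R>1$, $0<\alpha<1$ and $0<\beta\le\beta_0$ the following hold. (a) For all $\varepsilon>0$, $0<\delta<1$ and every integer $$n\ \ge\ C\left(\frac{\log(1/\beta)}{\alpha^2}+\frac{\log(1/\beta)}{\varepsilon\,\alpha^{k/(k-1)}}+\frac{\log(1/\delta)\log(1/\beta)}{\varepsilon}\right)$$ there is an $(\varepsilon,\delta)$-DP algorithm $M$ taking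 $n$ samples such that, for every probability distribution $\mathcal{D}$ on $\mathbb{R}$ with mean $\mu\in[-R,R]$ and $\mathbb{E}_{X\sim\mathcal{D}}|X-\mu|^k\le 1$, the output $\hat\mu$ of $M$ on $n$ independent samples from $\mathcal{D}$ satisfies $|\mu-\hat\mu|\le\alpha$ with probability at least $1-\beta$. (b) For all $\rho>0$ and every integer $$n\ \ge\ C\left(\frac{\log(1/\beta)}{\alpha^2}+\frac{\log(1/\beta)}{\sqrt{\rho}\,\alpha^{k/(k-1)}}+\frac{\sqrt{\log R}\,\log(1/\beta)}{\sqrt{\rho}}\right)$$ there is a $\rho$-zCDP algorithm $M$ taking $n$ samples with the same accuracy guarantee. -/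

import Mathlib

open MeasureTheory ProbabilityTheory
open scoped ENNReal

noncomputable section

/-- Two datasets of size `n` are neighbours if they differ in exactly one entry. -/
def Neighbours {n : ℕ} (x x' : Fin n → ℝ) : Prop :=
  hammingDist x x' = 1

/-- A randomized algorithm taking `n` real samples and returning a real number is a Markov kernel
`M`, where `M x` is the law of the output on the dataset `x`.  This is `(ε, δ)`-differential
privacy. -/
def IsDP {n : ℕ} (M : Kernel (Fin n → ℝ) ℝ) (ε δ : ℝ) : Prop :=
  ∀ x x' : Fin n → ℝ, Neighbours x x' → ∀ S : Set ℝ, MeasurableSet S →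
    M x S ≤ ENNReal.ofReal (Real.exp ε) * M x' S + ENNReal.ofReal δ

open Classical in
/-- The Rényi divergence `D_a(P ‖ Q) = (a - 1)⁻¹ log ∫ (dP/dQ)^a dQ` of order `a > 1`, with value
`∞` if `P` is not absolutely continuous with respect to `Q`. -/
def renyiDiv (a : ℝ) (P Q : Measure ℝ) : EReal :=
  if P ≪ Q then (((a - 1)⁻¹ : ℝ) : EReal) * ENNReal.log (∫⁻ y, P.rnDeriv Q y ^ a ∂Q) else ⊤

/-- `ρ`-zero-concentrated differential privacy. -/
def IsZCDP {n : ℕ} (M : Kernel (Fin n → ℝ) ℝ) (ρ : ℝ) : Prop :=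
  ∀ x x' : Fin n → ℝ, Neighbours x x' → ∀ a : ℝ, 1 < a →
    renyiDiv a (M x) (M x') ≤ ((ρ * a : ℝ) : EReal)

/-- `D` has mean `μ`, and its `k`-th absolute central moment is finite and at most `B`. -/
def HasMeanAndMoment (D : Measure ℝ) (μ k B : ℝ) : Prop :=
  Integrable (fun x => x) D ∧ ∫ x, x ∂D = μ ∧
    Integrable (fun x => |x - μ| ^ k) D ∧ ∫ x, |x - μ| ^ k ∂D ≤ B

/-- For every probability distribution `D` on `ℝ` with mean `μ ∈ [-R, R]` and `k`-th moment bounded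
by `1`, the output of `M` on `n` independent samples from `D` is within `α` of `μ` with probability
at least `1 - β`. -/
def EstimatesMean {n : ℕ} (M : Kernel (Fin n → ℝ) ℝ) (k R α β : ℝ) : Prop :=
  ∀ (D : Measure ℝ) [IsProbabilityMeasure D] (μ : ℝ), μ ∈ Set.Icc (-R) R →
    HasMeanAndMoment D μ k 1 →
    ENNReal.ofReal (1 - β) ≤
      (M ∘ₘ Measure.pi (fun _ : Fin n => D)) {y : ℝ | |μ - y| ≤ α}

end

/-! The estimator has two stages, both run on the same sample. The coarse stage privately selects a
cell of width 8 near `μ`; the fine stage averages the data clipped to a window of radius `16 * A`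
around the left end of that cell and adds noise.

The scale is `A = α ^ (-1 / (k - 1))`. By the moment bound, clipping there moves the mean by at most
`α / 4`. One sample moves the clipped mean by at most `32 * A / n`, so noise of order `A / (n * ε)`
(Laplace) or `A / (n * √ρ)` (Gaussian) suffices; since `A / α = α ^ (-k / (k - 1))`, this is the
middle term of the sample size. Clipping does not increase the variance bound, and `α * A ≤ 1` (from
`2 ≤ k`) keeps deviations of order `α` in the sub-Gaussian range of Bernstein's inequality. So a
single clipped mean has failure probability exponentially small in `n * α ^ 2`, with no median of
means (`measure_clippedMean_le`).

With high probability four fifths of the data lie within 4 of `μ`, hence in two adjacent cells, one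
of which holds `2 * n / 5` points. For (a) a cell is drawn with weight `exp (ε * count) - 1`, plus a
default weight `exp ε / δ` on one cell. Other empty cells have weight zero, so the cost is `log (1 /
δ)` and does not depend on `R`. For (b) the largest count after Gaussian noise is taken; a union
bound over the order of `R` cells costs `log R` in the exponent `n ^ 2 * ρ`.

Both privacy notions are handled through inequalities between integrals of test functions
(`DPDominated`, `RenyiDominated`), which compose without reference to densities of kernels. Accuracy
needs no sample splitting: the only two good centres are fixed by `μ`, and a union bound covers both
(`estimatesMean_seqKernel`). -/

/-! ### Kernels for adaptive composition and additive noise -/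

/-- Run `κ` on the data, then run `η` on the data and the output of `κ`; release the result. -/
noncomputable def seqKernel {X ι Y : Type*} [MeasurableSpace X] [MeasurableSpace ι]
    [MeasurableSpace Y] (κ : Kernel X ι) (η : Kernel (X × ι) Y) : Kernel X Y :=
  (κ ⊗ₖ η).snd

/-- The law of `F x z`, where `z` has law `ν`. -/
noncomputable def noiseKernel {X Z Y : Type*} [MeasurableSpace X] [MeasurableSpace Z]
    [MeasurableSpace Y] (ν : Measure Z) (F : X × Z → Y) : Kernel X Y :=
  (Kernel.id ×ₖ Kernel.const X ν).map F

section Kernels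
variable {X ι Y Z : Type*} [MeasurableSpace X] [MeasurableSpace ι] [MeasurableSpace Y]
  [MeasurableSpace Z]

instance seqKernel_isMarkov (κ : Kernel X ι) (η : Kernel (X × ι) Y) [IsMarkovKernel κ]
    [IsMarkovKernel η] : IsMarkovKernel (seqKernel κ η) := by
  unfold seqKernel; infer_instance

theorem lintegral_seqKernel (κ : Kernel X ι) (η : Kernel (X × ι) Y) [IsMarkovKernel κ]
    [IsMarkovKernel η] (x : X) {f : Y → ℝ≥0∞} (hf : Measurable f) :
    ∫⁻ y, f y ∂(seqKernel κ η x) = ∫⁻ m, ∫⁻ y, f y ∂(η (x, m)) ∂(κ x) := by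
  unfold seqKernel
  rw [Kernel.lintegral_snd _ _ hf, Kernel.lintegral_compProd _ _ _ (by fun_prop)]

theorem seqKernel_apply (κ : Kernel X ι) (η : Kernel (X × ι) Y) [IsMarkovKernel κ]
    [IsMarkovKernel η] (x : X) {S : Set Y} (hS : MeasurableSet S) :
    seqKernel κ η x S = ∫⁻ m, η (x, m) S ∂(κ x) := by
  have := lintegral_seqKernel κ η x (f := S.indicator 1) (measurable_one.indicator hS)
  simpa [lintegral_indicator_one hS] using this

theorem noiseKernel_isMarkov (ν : Measure Z) [IsProbabilityMeasure ν] {F : X × Z → Y}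
    (hF : Measurable F) : IsMarkovKernel (noiseKernel ν F) := by
  unfold noiseKernel; exact Kernel.IsMarkovKernel.map _ hF

theorem noiseKernel_apply (ν : Measure Z) [IsProbabilityMeasure ν] {F : X × Z → Y}
    (hF : Measurable F) (x : X) : noiseKernel ν F x = ν.map (fun z => F (x, z)) := by
  unfold noiseKernel
  rw [Kernel.map_apply _ hF, Kernel.prod_apply, Kernel.id_apply, Kernel.const_apply,
    Measure.dirac_prod, Measure.map_map hF (by fun_prop)]
  rfl

end Kernels

/-! ### Dual forms of the privacy guarantees and their composition -/

/-- Functional form of `(log c, d)`-indistinguishability of two measures. -/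
def DPDominated {Ω : Type*} [MeasurableSpace Ω] (c d : ℝ≥0∞) (P Q : Measure Ω) : Prop :=
  ∀ f : Ω → ℝ≥0∞, Measurable f → (∀ ω, f ω ≤ 1) → ∫⁻ ω, f ω ∂P ≤ c * ∫⁻ ω, f ω ∂Q + d

/-- Dual form, by Hölder's inequality, of the bound `D_a(P ‖ Q) ≤ ρ a`. -/
def RenyiDominated {Ω : Type*} [MeasurableSpace Ω] (a ρ : ℝ) (P Q : Measure Ω) : Prop :=
  ∀ f : Ω → ℝ≥0∞, Measurable f →
    ∫⁻ ω, f ω ∂P ≤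
      ENNReal.ofReal (Real.exp ((a - 1) * ρ)) * (∫⁻ ω, f ω ^ (a / (a - 1)) ∂Q) ^ ((a - 1) / a)

section Composition
variable {X ι Y Ω Ω' : Type*} [MeasurableSpace X] [MeasurableSpace ι] [MeasurableSpace Y]
  [MeasurableSpace Ω] [MeasurableSpace Ω']

theorem DPDominated.seqKernel {κ : Kernel X ι} {η : Kernel (X × ι) Y} [IsMarkovKernel κ]
    [IsMarkovKernel η] {x x' : X} {c₁ c₂ d : ℝ≥0∞} (hκ : DPDominated c₁ d (κ x) (κ x'))
    (hη : ∀ m, DPDominated c₂ 0 (η (x, m)) (η (x', m))) :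
    DPDominated (c₁ * c₂) d (seqKernel κ η x) (seqKernel κ η x') := by
  intro f hf hf1
  rw [lintegral_seqKernel _ _ _ hf, lintegral_seqKernel _ _ _ hf]
  have hm : Measurable fun m => ∫⁻ y, f y ∂(η (x', m)) :=
    (Measurable.lintegral_kernel (κ := η) hf).comp measurable_prodMk_left
  calc ∫⁻ m, ∫⁻ y, f y ∂(η (x, m)) ∂(κ x)
      -- The truncation at 1 makes the inner bound an admissible test function for `hκ`, so `d` is
      -- paid only once and is not multiplied by `c₂`.
      ≤ ∫⁻ m, min 1 (c₂ * ∫⁻ y, f y ∂(η (x', m))) ∂(κ x) := by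
        refine lintegral_mono fun m => le_min ?_ (by simpa using hη m f hf hf1)
        calc ∫⁻ y, f y ∂(η (x, m)) ≤ ∫⁻ _, 1 ∂(η (x, m)) := lintegral_mono hf1
          _ = 1 := by simp
    _ ≤ c₁ * ∫⁻ m, min 1 (c₂ * ∫⁻ y, f y ∂(η (x', m))) ∂(κ x') + d :=
        hκ _ (measurable_const.min (hm.const_mul _)) fun m => min_le_left _ _
    _ ≤ c₁ * ∫⁻ m, c₂ * ∫⁻ y, f y ∂(η (x', m)) ∂(κ x') + d := by
        gcongr; exact min_le_right _ _
    _ = c₁ * c₂ * ∫⁻ m, ∫⁻ y, f y ∂(η (x', m)) ∂(κ x') + d := by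
        rw [lintegral_const_mul _ hm, mul_assoc]

theorem DPDominated.measure_le {P Q : Measure Ω} {c d : ℝ≥0∞} (h : DPDominated c d P Q)
    {S : Set Ω} (hS : MeasurableSet S) : P S ≤ c * Q S + d := by
  have := h (S.indicator 1) (measurable_one.indicator hS)
    (fun ω => Set.indicator_le_self' (by simp) ω)
  simpa [lintegral_indicator_one hS] using this

theorem RenyiDominated.map {P Q : Measure Ω} {a ρ : ℝ} (h : RenyiDominated a ρ P Q) {g : Ω → Ω'}
    (hg : Measurable g) : RenyiDominated a ρ (P.map g) (Q.map g) := by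
  intro f hf
  rw [lintegral_map hf hg, lintegral_map (hf.pow_const _) hg]
  exact h _ (hf.comp hg)

/-- The `L^p(Q)` norm on the right, `p = a / (a - 1)`, iterates: the inner norm raised to the power
`p` is again an integral, so applying the hypothesis inside and then outside multiplies the two
constants. -/
theorem RenyiDominated.seqKernel {κ : Kernel X ι} {η : Kernel (X × ι) Y} [IsMarkovKernel κ]
    [IsMarkovKernel η] {x x' : X} {a ρ₁ ρ₂ : ℝ} (ha : 1 < a)
    (hκ : RenyiDominated a ρ₁ (κ x) (κ x'))
    (hη : ∀ m, RenyiDominated a ρ₂ (η (x, m)) (η (x', m))) :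
    RenyiDominated a (ρ₁ + ρ₂) (seqKernel κ η x) (seqKernel κ η x') := by
  intro f hf
  rw [lintegral_seqKernel _ _ _ hf, lintegral_seqKernel _ _ _ (hf.pow_const _)]
  have hm : Measurable fun m => ∫⁻ y, f y ^ (a / (a - 1)) ∂(η (x', m)) :=
    (Measurable.lintegral_kernel (κ := η) (hf.pow_const _)).comp measurable_prodMk_left
  have hinv : (a - 1) / a * (a / (a - 1)) = 1 := by
    have : a - 1 ≠ 0 := by linarith
    have : a ≠ 0 := by linarith
    field_simp
  calc ∫⁻ m, ∫⁻ y, f y ∂(η (x, m)) ∂(κ x)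
      ≤ ∫⁻ m, ENNReal.ofReal (Real.exp ((a - 1) * ρ₂)) *
          (∫⁻ y, f y ^ (a / (a - 1)) ∂(η (x', m))) ^ ((a - 1) / a) ∂(κ x) :=
        lintegral_mono fun m => hη m f hf
    _ = ENNReal.ofReal (Real.exp ((a - 1) * ρ₂)) *
          ∫⁻ m, (∫⁻ y, f y ^ (a / (a - 1)) ∂(η (x', m))) ^ ((a - 1) / a) ∂(κ x) :=
        lintegral_const_mul _ (hm.pow_const _)
    _ ≤ ENNReal.ofReal (Real.exp ((a - 1) * ρ₂)) * (ENNReal.ofReal (Real.exp ((a - 1) * ρ₁)) *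
          (∫⁻ m, ((∫⁻ y, f y ^ (a / (a - 1)) ∂(η (x', m))) ^ ((a - 1) / a)) ^ (a / (a - 1))
            ∂(κ x')) ^ ((a - 1) / a)) := by
        gcongr; exact hκ _ (hm.pow_const _)
    _ = _ := by
        simp_rw [← ENNReal.rpow_mul, hinv, ENNReal.rpow_one]
        rw [← mul_assoc, ← ENNReal.ofReal_mul (Real.exp_nonneg _), ← Real.exp_add]
        congr 3; ring

theorem RenyiDominated.absolutelyContinuous {P Q : Measure Ω} {a ρ : ℝ} (ha : 1 < a)
    (h : RenyiDominated a ρ P Q) : P ≪ Q := by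
  refine Measure.AbsolutelyContinuous.mk fun s hs hQ => ?_
  have h1 : 0 < a / (a - 1) := div_pos (by linarith) (by linarith)
  have h2 : 0 < (a - 1) / a := div_pos (by linarith) (by linarith)
  have := h (s.indicator 1) (measurable_one.indicator hs)
  have h3 : ∀ ω, (s.indicator (1 : Ω → ℝ≥0∞) ω) ^ (a / (a - 1)) = s.indicator 1 ω := by
    intro ω
    by_cases hω : ω ∈ s <;> simp [hω, h1]
  simp_rw [h3, lintegral_indicator_one hs, hQ, ENNReal.zero_rpow_of_pos h2] at this
  simpa using this

/-- Converse half of Hölder duality. With `g = dP/dQ`, the extremal test function `g ^ (a - 1)`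
gives `I ≤ c * I ^ ((a - 1) / a)` for `I = ∫ g ^ a ∂Q`, whence `I ≤ c ^ a`. Dividing needs `I`
finite, so `g` is first truncated at `N` and monotone convergence removes the truncation. -/
theorem RenyiDominated.lintegral_rnDeriv_le {P Q : Measure Ω} [IsFiniteMeasure P]
    [IsFiniteMeasure Q] {a ρ : ℝ} (ha : 1 < a) (h : RenyiDominated a ρ P Q) :
    ∫⁻ ω, P.rnDeriv Q ω ^ a ∂Q ≤ ENNReal.ofReal (Real.exp ((a - 1) * (ρ * a))) := by
  have ha0 : 0 < a := by linarith
  have ha1 : 0 < a - 1 := by linarith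
  set g := P.rnDeriv Q with hg
  have hgm : Measurable g := Measure.measurable_rnDeriv P Q
  have hP : P = Q.withDensity g :=
    (Measure.withDensity_rnDeriv_eq P Q (h.absolutelyContinuous ha)).symm
  have key : ∀ N : ℕ, ∫⁻ ω, (min (g ω) N) ^ a ∂Q ≤
      ENNReal.ofReal (Real.exp ((a - 1) * (ρ * a))) := by
    intro N
    set I := ∫⁻ ω, (min (g ω) N) ^ a ∂Q with hI
    have hNm : Measurable fun ω => min (g ω) (N : ℝ≥0∞) := hgm.min measurable_const
    have hIfin : I ≠ ∞ := by
      have : I ≤ ∫⁻ _, (N : ℝ≥0∞) ^ a ∂Q :=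
        lintegral_mono fun ω => ENNReal.rpow_le_rpow (min_le_right _ _) ha0.le
      refine ne_top_of_le_ne_top ?_ this
      rw [lintegral_const]
      exact ENNReal.mul_ne_top (ENNReal.rpow_ne_top_of_nonneg ha0.le (by simp))
        (measure_ne_top _ _)
    have h1 : I ≤ ENNReal.ofReal (Real.exp ((a - 1) * ρ)) * I ^ ((a - 1) / a) := by
      calc I ≤ ∫⁻ ω, g ω * (min (g ω) N) ^ (a - 1) ∂Q := by
            refine lintegral_mono fun ω => ?_
            have : (min (g ω) (N : ℝ≥0∞)) ^ a =
                (min (g ω) (N : ℝ≥0∞)) * (min (g ω) (N : ℝ≥0∞)) ^ (a - 1) := by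
              have := ENNReal.rpow_add_of_nonneg (x := min (g ω) (N : ℝ≥0∞)) 1 (a - 1)
                zero_le_one ha1.le
              rwa [ENNReal.rpow_one, add_sub_cancel] at this
            rw [this]
            gcongr
            exact min_le_left _ _
        _ = ∫⁻ ω, (min (g ω) N) ^ (a - 1) ∂P := by
            conv_rhs => rw [hP]
            rw [lintegral_withDensity_eq_lintegral_mul _ hgm (hNm.pow_const _)]
            rfl
        _ ≤ _ := by
            refine (h _ (hNm.pow_const _)).trans_eq ?_
            simp_rw [← ENNReal.rpow_mul]
            have : (a - 1) * (a / (a - 1)) = a := by field_simp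
            rw [this]
    by_cases hI0 : I = 0
    · simp [hI0]
    have hpos : 0 < I ^ ((a - 1) / a) := ENNReal.rpow_pos (pos_iff_ne_zero.2 hI0) hIfin
    have hfin : I ^ ((a - 1) / a) ≠ ∞ := ENNReal.rpow_ne_top_of_nonneg (by positivity) hIfin
    have h2 : I ^ (1 / a) ≤ ENNReal.ofReal (Real.exp ((a - 1) * ρ)) := by
      have : I = I ^ (1 / a) * I ^ ((a - 1) / a) := by
        rw [← ENNReal.rpow_add _ _ hI0 hIfin]
        have : 1 / a + (a - 1) / a = 1 := by field_simp; ring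
        rw [this, ENNReal.rpow_one]
      nth_rewrite 1 [this] at h1
      exact (ENNReal.mul_le_mul_iff_left hpos.ne' hfin).1 h1
    calc I = (I ^ (1 / a)) ^ a := by
          rw [← ENNReal.rpow_mul, one_div_mul_cancel ha0.ne', ENNReal.rpow_one]
      _ ≤ (ENNReal.ofReal (Real.exp ((a - 1) * ρ))) ^ a := ENNReal.rpow_le_rpow h2 ha0.le
      _ = _ := by
          rw [ENNReal.ofReal_rpow_of_pos (Real.exp_pos _), ← Real.exp_mul, mul_assoc]
  have hsup : ∀ ω, g ω ^ a = ⨆ N : ℕ, (min (g ω) N) ^ a := by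
    intro ω
    have h1 : g ω = ⨆ N : ℕ, min (g ω) (N : ℝ≥0∞) := by
      rw [← inf_iSup_eq, ENNReal.iSup_natCast]; simp
    conv_lhs => rw [h1]
    exact (ENNReal.monotone_rpow_of_nonneg ha0.le).map_iSup_of_continuousAt
      (ENNReal.continuous_rpow_const.continuousAt) (by simp [ha0])
  simp_rw [hsup]
  rw [lintegral_iSup (fun N => (hgm.min measurable_const).pow_const _)]
  · exact iSup_le key
  · intro N N' hN ω
    exact ENNReal.rpow_le_rpow (min_le_min le_rfl (by exact_mod_cast hN)) ha0.le

theorem RenyiDominated.renyiDiv_le {P Q : Measure ℝ} [IsFiniteMeasure P]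
    [IsFiniteMeasure Q] {a ρ : ℝ} (ha : 1 < a) (h : RenyiDominated a ρ P Q) :
    renyiDiv a P Q ≤ ((ρ * a : ℝ) : EReal) := by
  rw [renyiDiv, if_pos (h.absolutelyContinuous ha)]
  have ha1 : 0 < a - 1 := by linarith
  have h1 : ENNReal.log (∫⁻ y, P.rnDeriv Q y ^ a ∂Q) ≤ (((a - 1) * (ρ * a) : ℝ) : EReal) := by
    refine (ENNReal.log_monotone (h.lintegral_rnDeriv_le ha)).trans_eq ?_
    rw [ENNReal.log_ofReal_of_pos (Real.exp_pos _), Real.log_exp]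
  calc (((a - 1)⁻¹ : ℝ) : EReal) * ENNReal.log (∫⁻ y, P.rnDeriv Q y ^ a ∂Q)
      ≤ (((a - 1)⁻¹ : ℝ) : EReal) * (((a - 1) * (ρ * a) : ℝ) : EReal) := by
        refine mul_le_mul_of_nonneg_left h1 ?_
        exact_mod_cast (inv_nonneg.2 ha1.le)
    _ = _ := by
        rw [← EReal.coe_mul, inv_mul_cancel_left₀ ha1.ne']

end Composition

/-! ### Laplace noise -/

section Laplace

/-- The density of the centred Laplace distribution of scale `b`. -/
noncomputable def laplacePDF (b : ℝ) (y : ℝ) : ℝ≥0∞ :=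
  ENNReal.ofReal ((2 * b)⁻¹ * Real.exp (-(1 / b) * |y|))

/-- The centred Laplace distribution of scale `b`. -/
noncomputable def laplaceMeasure (b : ℝ) : Measure ℝ := volume.withDensity (laplacePDF b)

theorem measurable_laplacePDF (b : ℝ) : Measurable (laplacePDF b) := by
  unfold laplacePDF
  fun_prop

theorem integral_exp_neg_mul_abs {c : ℝ} (hc : 0 < c) : ∫ y : ℝ, Real.exp (-c * |y|) = 2 / c := by
  rw [integral_comp_abs (f := fun y => Real.exp (-c * y)), integral_exp_mul_Ioi (by linarith)]
  simp only [mul_zero, Real.exp_zero]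
  field_simp

theorem integrable_exp_neg_mul_abs {c : ℝ} (hc : 0 < c) :
    Integrable fun y : ℝ => Real.exp (-c * |y|) :=
  Integrable.of_integral_ne_zero (by rw [integral_exp_neg_mul_abs hc]; positivity)

theorem lintegral_exp_neg_mul_abs {b c : ℝ} (hb : 0 < b) (hc : 0 < c) :
    ∫⁻ y : ℝ, ENNReal.ofReal ((2 * b)⁻¹ * Real.exp (-c * |y|)) = ENNReal.ofReal (1 / (b * c)) := by
  rw [← ofReal_integral_eq_lintegral_ofReal ((integrable_exp_neg_mul_abs hc).const_mul _)
    (Filter.Eventually.of_forall fun y => by positivity), integral_const_mul,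
    integral_exp_neg_mul_abs hc]
  congr 1
  field_simp

theorem isProbabilityMeasure_laplaceMeasure {b : ℝ} (hb : 0 < b) :
    IsProbabilityMeasure (laplaceMeasure b) := by
  refine ⟨?_⟩
  rw [laplaceMeasure, withDensity_apply _ MeasurableSet.univ, Measure.restrict_univ]
  unfold laplacePDF
  rw [lintegral_exp_neg_mul_abs hb (by positivity)]
  rw [mul_one_div_cancel hb.ne']; simp

/-- Half of the exponent is at least `t / (2 * b)` on the event; the other half is integrated over
the whole line and contributes the factor 2. -/
theorem laplaceMeasure_abs_gt_le {b t : ℝ} (hb : 0 < b) :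
    laplaceMeasure b {z | t < |z|} ≤ ENNReal.ofReal (2 * Real.exp (-(t / (2 * b)))) := by
  have hS : MeasurableSet {z : ℝ | t < |z|} := measurableSet_lt measurable_const (by fun_prop)
  rw [laplaceMeasure, withDensity_apply _ hS]
  calc ∫⁻ y in {z | t < |z|}, laplacePDF b y
      ≤ ∫⁻ y in {z | t < |z|}, ENNReal.ofReal (Real.exp (-(t / (2 * b)))) *
          ENNReal.ofReal ((2 * b)⁻¹ * Real.exp (-(1 / (2 * b)) * |y|)) := by
        refine setLIntegral_mono' hS fun y hy => ?_
        rw [laplacePDF, ← ENNReal.ofReal_mul (Real.exp_nonneg _)]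
        apply ENNReal.ofReal_le_ofReal
        rw [mul_left_comm, ← Real.exp_add]
        gcongr
        have : t / (2 * b) ≤ |y| / (2 * b) := by
          have : t ≤ |y| := le_of_lt hy
          gcongr
        have h2 : 1 / b * |y| = |y| / (2 * b) + |y| / (2 * b) := by field_simp; ring
        have h3 : 1 / (2 * b) * |y| = |y| / (2 * b) := by field_simp
        nlinarith
    _ ≤ ∫⁻ y, ENNReal.ofReal (Real.exp (-(t / (2 * b)))) *
          ENNReal.ofReal ((2 * b)⁻¹ * Real.exp (-(1 / (2 * b)) * |y|)) :=
        setLIntegral_le_lintegral _ _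
    _ = _ := by
        rw [lintegral_const_mul _ (by fun_prop), lintegral_exp_neg_mul_abs hb (by positivity),
          ← ENNReal.ofReal_mul (Real.exp_nonneg _)]
        congr 1
        field_simp

theorem lintegral_map_laplace (b m : ℝ) {f : ℝ → ℝ≥0∞} (hf : Measurable f) :
    ∫⁻ y, f y ∂((laplaceMeasure b).map fun z => m + z) = ∫⁻ y, laplacePDF b (y - m) * f y := by
  rw [lintegral_map hf (by fun_prop), laplaceMeasure,
    lintegral_withDensity_eq_lintegral_mul _ (measurable_laplacePDF b) (by fun_prop),
    ← lintegral_add_left_eq_self (fun y => laplacePDF b (y - m) * f y) m]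
  simp

theorem dpDominated_laplace {b ε m m' : ℝ} (hb : 0 < b) (h : |m - m'| ≤ ε * b) :
    DPDominated (ENNReal.ofReal (Real.exp ε)) 0 ((laplaceMeasure b).map fun z => m + z)
      ((laplaceMeasure b).map fun z => m' + z) := by
  intro f hf _
  rw [lintegral_map_laplace b m hf, lintegral_map_laplace b m' hf, add_zero,
    ← lintegral_const_mul' _ _ (by simp)]
  refine lintegral_mono fun y => ?_
  rw [← mul_assoc]
  gcongr
  rw [laplacePDF, laplacePDF, ← ENNReal.ofReal_mul (Real.exp_nonneg _)]
  apply ENNReal.ofReal_le_ofReal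
  rw [mul_left_comm, ← Real.exp_add]
  gcongr
  have h1 : |y - m'| ≤ |y - m| + ε * b := by
    have := abs_add_le (y - m) (m - m')
    rw [show y - m + (m - m') = y - m' by ring] at this
    linarith
  have h2 : 1 / b * |y - m'| ≤ 1 / b * (|y - m| + ε * b) := by gcongr
  have h3 : 1 / b * (|y - m| + ε * b) = 1 / b * |y - m| + ε := by field_simp
  linarith

end Laplace

/-! ### Gaussian noise and Rényi divergence -/

section Gaussian

/-- Completing the square shows that `p_m ^ a * p_m' ^ (1 - a)` is a multiple of the Gaussian
density centred at `a * m + (1 - a) * m'`. In this form Hölder's inequality applies directly, and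
the last factor integrates to 1. -/
theorem gaussianPDF_eq_mul_rpow {m m' a : ℝ} {v : NNReal} (hv : v ≠ 0) (ha : 1 < a) (y : ℝ) :
    gaussianPDF m v y = ENNReal.ofReal (Real.exp ((a - 1) * ((m - m') ^ 2 / (2 * v)))) *
      (gaussianPDF m' v y ^ ((a - 1) / a) * gaussianPDF (a * m + (1 - a) * m') v y ^ (1 / a)) := by
  have ha0 : 0 < a := by linarith
  have hv' : (0 : ℝ) < v := NNReal.coe_pos.2 (pos_iff_ne_zero.2 hv)
  unfold gaussianPDF
  rw [ENNReal.ofReal_rpow_of_pos (gaussianPDFReal_pos _ _ _ hv),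
    ENNReal.ofReal_rpow_of_pos (gaussianPDFReal_pos _ _ _ hv),
    ← ENNReal.ofReal_mul (Real.rpow_nonneg (gaussianPDFReal_nonneg _ _ _) _),
    ← ENNReal.ofReal_mul (Real.exp_nonneg _)]
  congr 1
  unfold gaussianPDFReal
  set s := (√(2 * Real.pi * v))⁻¹ with hs
  have hs0 : 0 < s := by positivity
  rw [Real.mul_rpow hs0.le (Real.exp_nonneg _), Real.mul_rpow hs0.le (Real.exp_nonneg _),
    ← Real.exp_mul, ← Real.exp_mul]
  have h1 : s ^ ((a - 1) / a) * s ^ (1 / a) = s := by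
    rw [← Real.rpow_add hs0]
    have : (a - 1) / a + 1 / a = 1 := by field_simp; ring
    rw [this, Real.rpow_one]
  calc s * Real.exp (-(y - m) ^ 2 / (2 * v))
      = s * Real.exp ((a - 1) * ((m - m') ^ 2 / (2 * v)) + -(y - m') ^ 2 / (2 * v) * ((a - 1) / a) +
          -(y - (a * m + (1 - a) * m')) ^ 2 / (2 * v) * (1 / a)) := by
        congr 2
        field_simp
        ring
    _ = _ := by
        rw [Real.exp_add, Real.exp_add]
        nth_rewrite 1 [← h1]
        ring

theorem renyiDominated_gaussianReal {m m' a : ℝ} {v : NNReal} (hv : v ≠ 0) (ha : 1 < a) :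
    RenyiDominated a ((m - m') ^ 2 / (2 * v)) (gaussianReal m v) (gaussianReal m' v) := by
  intro f hf
  have ha0 : 0 < a := by linarith
  have ha1 : 0 < a - 1 := by linarith
  have hpq : (a / (a - 1)).HolderConjugate a :=
    (Real.HolderConjugate.conjExponent ha).symm
  rw [gaussianReal_of_var_ne_zero _ hv, gaussianReal_of_var_ne_zero _ hv,
    lintegral_withDensity_eq_lintegral_mul _ (measurable_gaussianPDF _ _) hf,
    lintegral_withDensity_eq_lintegral_mul _ (measurable_gaussianPDF _ _) (hf.pow_const _)]
  have hm : Measurable fun y => gaussianPDF m' v y ^ ((a - 1) / a) * f y :=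
    ((measurable_gaussianPDF _ _).pow_const _).mul hf
  have hm' : Measurable fun y => gaussianPDF (a * m + (1 - a) * m') v y ^ (1 / a) :=
    (measurable_gaussianPDF _ _).pow_const _
  calc ∫⁻ y, (gaussianPDF m v * f) y
      = ENNReal.ofReal (Real.exp ((a - 1) * ((m - m') ^ 2 / (2 * v)))) *
        ∫⁻ y, ((fun y => gaussianPDF m' v y ^ ((a - 1) / a) * f y) *
          fun y => gaussianPDF (a * m + (1 - a) * m') v y ^ (1 / a)) y := by
        rw [← lintegral_const_mul _ (hm.mul hm')]
        refine lintegral_congr fun y => ?_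
        simp only [Pi.mul_apply]
        rw [gaussianPDF_eq_mul_rpow (m' := m') hv ha]
        ring
    _ ≤ _ := by
        gcongr
        refine (ENNReal.lintegral_mul_le_Lp_mul_Lq volume hpq hm.aemeasurable
          hm'.aemeasurable).trans_eq ?_
        have h1 : (a - 1) / a * (a / (a - 1)) = 1 := by field_simp
        simp_rw [ENNReal.mul_rpow_of_nonneg _ _ hpq.nonneg, ← ENNReal.rpow_mul, h1,
          one_div_mul_cancel ha0.ne', ENNReal.rpow_one, lintegral_gaussianPDF_eq_one _ hv,
          ENNReal.one_rpow, mul_one, one_div_div]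
        rfl

/-- Tensorization by integrating one coordinate at a time, with the same iteration of norms as in
`RenyiDominated.seqKernel`. -/
theorem RenyiDominated.lmarginal {ι : Type*} [Fintype ι] [DecidableEq ι] {P Q : ι → Measure ℝ}
    [∀ i, IsProbabilityMeasure (P i)] [∀ i, IsProbabilityMeasure (Q i)] {a : ℝ} (ha : 1 < a)
    {ρ : ι → ℝ} (h : ∀ i, RenyiDominated a (ρ i) (P i) (Q i)) {f : (ι → ℝ) → ℝ≥0∞}
    (hf : Measurable f) (s : Finset ι) (x : ι → ℝ) :
    (∫⋯∫⁻_s, f ∂P) x ≤ ENNReal.ofReal (Real.exp ((a - 1) * ∑ i ∈ s, ρ i)) *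
      ((∫⋯∫⁻_s, (fun z => f z ^ (a / (a - 1))) ∂Q) x) ^ ((a - 1) / a) := by
  have ha0 : 0 < a := by linarith
  have ha1 : 0 < a - 1 := by linarith
  have hinv : (a - 1) / a * (a / (a - 1)) = 1 := by field_simp
  induction s using Finset.induction_on generalizing x with
  | empty =>
    simp only [lmarginal_empty, Finset.sum_empty, mul_zero, Real.exp_zero, ENNReal.ofReal_one,
      one_mul]
    rw [← ENNReal.rpow_mul, mul_comm, hinv, ENNReal.rpow_one]
  | insert i s hi ih =>
    rw [lmarginal_insert _ hf hi, lmarginal_insert _ (hf.pow_const _) hi, Finset.sum_insert hi]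
    set g : ℝ → ℝ≥0∞ := fun t =>
      (∫⋯∫⁻_s, (fun z => f z ^ (a / (a - 1))) ∂Q) (Function.update x i t) with hg
    have hgm : Measurable g :=
      ((hf.pow_const _).lmarginal Q).comp (measurable_update x)
    calc ∫⁻ t, (∫⋯∫⁻_s, f ∂P) (Function.update x i t) ∂P i
        ≤ ∫⁻ t, ENNReal.ofReal (Real.exp ((a - 1) * ∑ i ∈ s, ρ i)) * g t ^ ((a - 1) / a) ∂P i :=
          lintegral_mono fun t => ih _
      _ = ENNReal.ofReal (Real.exp ((a - 1) * ∑ i ∈ s, ρ i)) *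
            ∫⁻ t, g t ^ ((a - 1) / a) ∂P i := lintegral_const_mul _ (hgm.pow_const _)
      _ ≤ ENNReal.ofReal (Real.exp ((a - 1) * ∑ i ∈ s, ρ i)) *
            (ENNReal.ofReal (Real.exp ((a - 1) * ρ i)) *
              (∫⁻ t, (g t ^ ((a - 1) / a)) ^ (a / (a - 1)) ∂Q i) ^ ((a - 1) / a)) := by
          gcongr
          exact h i _ (hgm.pow_const _)
      _ = _ := by
          simp_rw [← ENNReal.rpow_mul, hinv, ENNReal.rpow_one]
          rw [← mul_assoc, ← ENNReal.ofReal_mul (Real.exp_nonneg _), ← Real.exp_add]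
          congr 3; ring

theorem RenyiDominated.pi {ι : Type*} [Fintype ι] {P Q : ι → Measure ℝ}
    [∀ i, IsProbabilityMeasure (P i)] [∀ i, IsProbabilityMeasure (Q i)] {a : ℝ} (ha : 1 < a)
    {ρ : ι → ℝ} (h : ∀ i, RenyiDominated a (ρ i) (P i) (Q i)) :
    RenyiDominated a (∑ i, ρ i) (Measure.pi P) (Measure.pi Q) := by
  classical
  intro f hf
  have := RenyiDominated.lmarginal ha h hf Finset.univ 0
  rwa [← lintegral_eq_lmarginal_univ, ← lintegral_eq_lmarginal_univ] at this

theorem RenyiDominated.mono {Ω : Type*} [MeasurableSpace Ω] {P Q : Measure Ω} {a ρ ρ' : ℝ}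
    (ha : 1 < a) (h : RenyiDominated a ρ P Q) (hρ : ρ ≤ ρ') : RenyiDominated a ρ' P Q := by
  intro f hf
  refine (h f hf).trans ?_
  gcongr

theorem gaussianReal_abs_ge_le {v : NNReal} (hv : v ≠ 0) {t : ℝ} (ht : 0 ≤ t) :
    gaussianReal 0 v {z | t ≤ |z|} ≤ ENNReal.ofReal (2 * Real.exp (-(t ^ 2 / (2 * v)))) := by
  have hv' : (0 : ℝ) < v := NNReal.coe_pos.2 (pos_iff_ne_zero.2 hv)
  have h1 : (gaussianReal 0 v).real {z | t ≤ id z} ≤ Real.exp (-(t ^ 2 / (2 * v))) := by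
    refine (measure_ge_le_exp_mul_mgf (t := t / v) t (by positivity)
      (integrable_exp_mul_gaussianReal _)).trans_eq ?_
    rw [mgf_fun_id_gaussianReal, ← Real.exp_add]
    congr 1
    field_simp
    ring
  have h2 : (gaussianReal 0 v).real {z | id z ≤ -t} ≤ Real.exp (-(t ^ 2 / (2 * v))) := by
    refine (measure_le_le_exp_mul_mgf (t := -(t / v)) (-t) (by simp; positivity)
      (integrable_exp_mul_gaussianReal _)).trans_eq ?_
    rw [mgf_fun_id_gaussianReal, ← Real.exp_add]
    congr 1
    field_simp
    ring
  rw [← ofReal_measureReal]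
  apply ENNReal.ofReal_le_ofReal
  have h3 : {z : ℝ | t ≤ |z|} ⊆ {z | t ≤ id z} ∪ {z | id z ≤ -t} := by
    intro z hz
    rcases le_abs.1 (show t ≤ |z| from hz) with h | h
    · exact Or.inl h
    · exact Or.inr (by simp only [id, Set.mem_ofPred_eq]; linarith)
  calc (gaussianReal 0 v).real {z | t ≤ |z|} ≤ _ := measureReal_mono h3
    _ ≤ _ := measureReal_union_le _ _
    _ ≤ _ := by linarith

end Gaussian

/-! ### Cell counts and their sensitivity -/

section CellCount
variable {ι : Type*} [DecidableEq ι] {n : ℕ}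

/-- The number of data points which fall into the cell `j`. -/
def cellCount (cell : ℝ → ι) (x : Fin n → ℝ) (j : ι) : ℝ :=
  ∑ i, if cell (x i) = j then 1 else 0

theorem cellCount_nonneg (cell : ℝ → ι) (x : Fin n → ℝ) (j : ι) : 0 ≤ cellCount cell x j :=
  Finset.sum_nonneg fun i _ => by split_ifs <;> norm_num

theorem measurable_cellCount [MeasurableSpace ι] [MeasurableSingletonClass ι] {cell : ℝ → ι}
    (hcell : Measurable cell) (j : ι) :
    Measurable fun x : Fin n → ℝ => cellCount cell x j := by
  unfold cellCount
  refine Finset.measurable_sum _ fun i _ => Measurable.ite ?_ measurable_const measurable_const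
  exact (hcell.comp (measurable_pi_apply i)) (measurableSet_singleton j)

theorem Neighbours.symm {x x' : Fin n → ℝ} (h : Neighbours x x') : Neighbours x' x := by
  unfold Neighbours at *
  rwa [hammingDist_comm]

theorem Neighbours.exists_index {x x' : Fin n → ℝ} (h : Neighbours x x') :
    ∃ i, ∀ l, l ≠ i → x l = x' l := by
  unfold Neighbours hammingDist at h
  obtain ⟨i, hi⟩ := Finset.card_eq_one.1 h
  refine ⟨i, fun l hl => ?_⟩
  by_contra hne
  have : l ∈ ({i} : Finset (Fin n)) := by rw [← hi]; simpa using hne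
  exact hl (by simpa using this)

theorem Neighbours.sum_sub_sum {x x' : Fin n → ℝ} (h : Neighbours x x') :
    ∃ i, ∀ g : ℝ → ℝ, ∑ l, g (x l) = ∑ l, g (x' l) + g (x i) - g (x' i) := by
  obtain ⟨i, hi⟩ := h.exists_index
  refine ⟨i, fun g => ?_⟩
  rw [← Finset.add_sum_erase _ (fun l => g (x l)) (Finset.mem_univ i),
    ← Finset.add_sum_erase _ (fun l => g (x' l)) (Finset.mem_univ i),
    Finset.sum_congr rfl fun l hl => by rw [hi l (Finset.ne_of_mem_erase hl)]]
  ring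

theorem Neighbours.cellCount_eq (cell : ℝ → ι) {x x' : Fin n → ℝ} (h : Neighbours x x') :
    ∃ p q : ι, ∀ j, cellCount cell x j =
      cellCount cell x' j + (if p = j then 1 else 0) - (if q = j then 1 else 0) := by
  obtain ⟨i, hi⟩ := h.sum_sub_sum
  exact ⟨cell (x i), cell (x' i), fun j => hi fun t => if cell t = j then 1 else 0⟩

theorem Neighbours.sum_sq_cellCount_le [Fintype ι] (cell : ℝ → ι) {x x' : Fin n → ℝ}
    (h : Neighbours x x') : ∑ j, (cellCount cell x j - cellCount cell x' j) ^ 2 ≤ 2 := by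
  obtain ⟨p, q, hpq⟩ := h.cellCount_eq cell
  calc ∑ j, (cellCount cell x j - cellCount cell x' j) ^ 2
      ≤ ∑ j, ((if p = j then (1 : ℝ) else 0) + if q = j then 1 else 0) := by
        refine Finset.sum_le_sum fun j _ => ?_
        rw [hpq j]
        split_ifs <;> norm_num
    _ = 2 := by
        rw [Finset.sum_add_distrib]
        simp
        norm_num

theorem sum_filter_cellCount [Fintype ι] (cell : ℝ → ι) (x : Fin n → ℝ) (G : Finset ι) :
    ∑ j ∈ G, cellCount cell x j = ∑ i, if cell (x i) ∈ G then (1 : ℝ) else 0 := by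
  unfold cellCount
  rw [Finset.sum_comm]
  refine Finset.sum_congr rfl fun i _ => ?_
  simp

end CellCount

/-! ### Sampling from a finite set with given weights -/

section WeightKernel
variable {X ι : Type*} [MeasurableSpace X] [Fintype ι] [MeasurableSpace ι]
  [DiscreteMeasurableSpace ι]

/-- Draw `j` with probability proportional to `W x j`. -/
noncomputable def weightKernel (W : X → ι → ℝ) : Kernel X ι :=
  Kernel.withDensity (Kernel.const X Measure.count)
    fun x j => ENNReal.ofReal (W x j / ∑ l, W x l)

theorem measurable_weight {W : X → ι → ℝ} (hW : ∀ j, Measurable fun x => W x j) :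
    Measurable (Function.uncurry fun x j => ENNReal.ofReal (W x j / ∑ l, W x l)) := by
  refine measurable_from_prod_countable_left fun j => ?_
  have := hW j
  simp only [Function.uncurry]
  fun_prop

theorem lintegral_weightKernel {W : X → ι → ℝ} (hW : ∀ j, Measurable fun x => W x j) (x : X)
    (f : ι → ℝ≥0∞) :
    ∫⁻ j, f j ∂(weightKernel W x) = ∑ j, ENNReal.ofReal (W x j / ∑ l, W x l) * f j := by
  unfold weightKernel
  rw [Kernel.lintegral_withDensity _ (measurable_weight hW) x (Measurable.of_discrete)]
  rw [Kernel.const_apply, lintegral_count, tsum_fintype]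

theorem weightKernel_isMarkov {W : X → ι → ℝ} (hW : ∀ j, Measurable fun x => W x j)
    (h0 : ∀ x j, 0 ≤ W x j) (hpos : ∀ x, 0 < ∑ l, W x l) : IsMarkovKernel (weightKernel W) := by
  refine ⟨fun x => ⟨?_⟩⟩
  have := lintegral_weightKernel hW x 1
  simp only [Pi.one_apply, lintegral_one, mul_one] at this
  rw [this, ← ENNReal.ofReal_sum_of_nonneg fun j _ => div_nonneg (h0 x j) (hpos x).le,
    ← Finset.sum_div, div_self (hpos x).ne', ENNReal.ofReal_one]

theorem dpDominated_weightKernel {W : X → ι → ℝ} (hW : ∀ j, Measurable fun x => W x j)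
    {x x' : X} {c δ : ℝ} (hc : 0 ≤ c) {η : ι → ℝ} (hη : ∀ j, 0 ≤ η j) (hδ : ∑ j, η j ≤ δ)
    (h : ∀ j, W x j / ∑ l, W x l ≤ c * (W x' j / ∑ l, W x' l) + η j) :
    DPDominated (ENNReal.ofReal c) (ENNReal.ofReal δ) (weightKernel W x) (weightKernel W x') := by
  intro f _ hf1
  rw [lintegral_weightKernel hW, lintegral_weightKernel hW]
  calc ∑ j, ENNReal.ofReal (W x j / ∑ l, W x l) * f j
      ≤ ∑ j, (ENNReal.ofReal c * (ENNReal.ofReal (W x' j / ∑ l, W x' l) * f j) +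
          ENNReal.ofReal (η j)) := by
        refine Finset.sum_le_sum fun j _ => ?_
        calc ENNReal.ofReal (W x j / ∑ l, W x l) * f j
            ≤ (ENNReal.ofReal c * ENNReal.ofReal (W x' j / ∑ l, W x' l) +
                ENNReal.ofReal (η j)) * f j := by
              gcongr
              rw [← ENNReal.ofReal_mul hc]
              exact (ENNReal.ofReal_le_ofReal (h j)).trans ENNReal.ofReal_add_le
          _ ≤ _ := by
              rw [add_mul, mul_assoc]
              gcongr
              exact mul_le_of_le_one_right' (hf1 j)
    _ = ENNReal.ofReal c * ∑ j, ENNReal.ofReal (W x' j / ∑ l, W x' l) * f j +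
          ENNReal.ofReal (∑ j, η j) := by
        rw [Finset.sum_add_distrib, Finset.mul_sum, ENNReal.ofReal_sum_of_nonneg fun j _ => hη j]
    _ ≤ _ := by gcongr

end WeightKernel

/-! ### The stable histogram for approximate differential privacy -/

section StableHistogram
variable {ι : Type*} [DecidableEq ι] {n : ℕ}

/-- Weights of the stable histogram: `exp (ε c) - 1` for a cell with `c` points, and an
additional weight `exp ε / δ` for a default cell. -/
noncomputable def histogramWeight (cell : ℝ → ι) (j₀ : ι) (ε δ : ℝ) (x : Fin n → ℝ) (j : ι) : ℝ :=
  (Real.exp (ε * cellCount cell x j) - 1) + if j₀ = j then Real.exp ε / δ else 0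

theorem exp_cellCount_sub_one_nonneg (cell : ℝ → ι) {ε : ℝ} (hε : 0 < ε) (x : Fin n → ℝ) (j : ι) :
    0 ≤ Real.exp (ε * cellCount cell x j) - 1 := by
  have := Real.add_one_le_exp (ε * cellCount cell x j)
  have h2 := mul_nonneg hε.le (cellCount_nonneg cell x j)
  linarith

theorem histogramWeight_nonneg (cell : ℝ → ι) (j₀ : ι) {ε δ : ℝ} (hε : 0 < ε) (hδ : 0 < δ)
    (x : Fin n → ℝ) (j : ι) : 0 ≤ histogramWeight cell j₀ ε δ x j := by
  unfold histogramWeight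
  refine add_nonneg (exp_cellCount_sub_one_nonneg cell hε x j) ?_
  split_ifs <;> positivity

/-- The identity `exp (ε * (c + 1)) - 1 = exp ε * (exp (ε * c) - 1) + (exp ε - 1)` confines the
additive error to the one cell `p` that may gain a point. -/
theorem Neighbours.histogramWeight_le (cell : ℝ → ι) (j₀ : ι) {ε δ : ℝ} (hε : 0 < ε)
    (hδ : 0 < δ) {x x' : Fin n → ℝ} (h : Neighbours x x') :
    ∃ p, ∀ j, histogramWeight cell j₀ ε δ x j ≤
      Real.exp ε * histogramWeight cell j₀ ε δ x' j +
        if p = j then Real.exp ε - 1 else 0 := by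
  obtain ⟨p, q, hpq⟩ := h.cellCount_eq cell
  have he : 1 < Real.exp ε := Real.one_lt_exp_iff.2 hε
  refine ⟨p, fun j => ?_⟩
  unfold histogramWeight
  have hK : (if j₀ = j then Real.exp ε / δ else 0) ≤
      Real.exp ε * if j₀ = j then Real.exp ε / δ else 0 := by
    have h0 : 0 ≤ if j₀ = j then Real.exp ε / δ else 0 := by split_ifs <;> positivity
    exact le_mul_of_one_le_left h0 he.le
  have h3 : cellCount cell x j ≤ cellCount cell x' j + if p = j then 1 else 0 := by
    have := hpq j
    have h4 : (0 : ℝ) ≤ if q = j then 1 else 0 := by split_ifs <;> norm_num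
    linarith
  have h6 := exp_cellCount_sub_one_nonneg cell hε x' j
  have h7 : Real.exp (ε * cellCount cell x j) - 1 ≤
      Real.exp ε * (Real.exp (ε * cellCount cell x' j) - 1) +
        if p = j then Real.exp ε - 1 else 0 := by
    split_ifs with hp
    · rw [if_pos hp] at h3
      calc Real.exp (ε * cellCount cell x j) - 1
          ≤ Real.exp (ε * (cellCount cell x' j + 1)) - 1 := by gcongr
        _ = Real.exp ε * Real.exp (ε * cellCount cell x' j) - 1 := by
            rw [← Real.exp_add]; congr 2; ring
        _ = _ := by ring
    · rw [if_neg hp, add_zero] at h3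
      have : Real.exp (ε * cellCount cell x j) ≤ Real.exp (ε * cellCount cell x' j) := by gcongr
      nlinarith
  linarith

variable [Fintype ι]

theorem sum_histogramWeight (cell : ℝ → ι) (j₀ : ι) (ε δ : ℝ) (x : Fin n → ℝ) :
    ∑ j, histogramWeight cell j₀ ε δ x j =
      ∑ j, (Real.exp (ε * cellCount cell x j) - 1) + Real.exp ε / δ := by
  unfold histogramWeight
  rw [Finset.sum_add_distrib]
  simp

theorem le_sum_histogramWeight (cell : ℝ → ι) (j₀ : ι) {ε δ : ℝ} (hε : 0 < ε) (x : Fin n → ℝ)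
    (j : ι) : Real.exp (ε * cellCount cell x j) - 1 + Real.exp ε / δ ≤
      ∑ j, histogramWeight cell j₀ ε δ x j := by
  rw [sum_histogramWeight]
  gcongr
  exact Finset.single_le_sum (f := fun j => Real.exp (ε * cellCount cell x j) - 1)
    (fun j _ => exp_cellCount_sub_one_nonneg cell hε x j) (Finset.mem_univ j)

theorem one_le_exp_div {ε δ : ℝ} (hε : 0 < ε) (hδ : 0 < δ) (hδ1 : δ < 1) : 1 ≤ Real.exp ε / δ := by
  rw [le_div_iff₀ hδ]
  linarith [Real.one_lt_exp_iff.2 hε]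

theorem exp_cellCount_le_sum_histogramWeight (cell : ℝ → ι) (j₀ : ι) {ε δ : ℝ} (hε : 0 < ε)
    (hδ : 0 < δ) (hδ1 : δ < 1) (x : Fin n → ℝ) (j : ι) :
    Real.exp (ε * cellCount cell x j) ≤ ∑ j, histogramWeight cell j₀ ε δ x j := by
  have := le_sum_histogramWeight cell j₀ (δ := δ) hε x j
  have := one_le_exp_div hε hδ hδ1
  linarith

theorem sum_histogramWeight_pos (cell : ℝ → ι) (j₀ : ι) {ε δ : ℝ} (hε : 0 < ε)
    (hδ : 0 < δ) (hδ1 : δ < 1) (x : Fin n → ℝ) : 0 < ∑ j, histogramWeight cell j₀ ε δ x j :=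
  (Real.exp_pos _).trans_le (exp_cellCount_le_sum_histogramWeight cell j₀ hε hδ hδ1 x j₀)

/-- The gain at the cell `p` is at most `(exp ε - 1) * exp (ε * c)`, and `exp (ε * c)` is at most
the total because the default weight makes up for the subtracted 1. -/
theorem Neighbours.sum_histogramWeight_le (cell : ℝ → ι) (j₀ : ι) {ε δ : ℝ} (hε : 0 < ε)
    (hδ : 0 < δ) (hδ1 : δ < 1) {x x' : Fin n → ℝ} (h : Neighbours x x') :
    ∑ j, histogramWeight cell j₀ ε δ x' j ≤
      Real.exp ε * ∑ j, histogramWeight cell j₀ ε δ x j := by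
  obtain ⟨p, q, hpq⟩ := h.symm.cellCount_eq cell
  have he : 1 < Real.exp ε := Real.one_lt_exp_iff.2 hε
  have h1 : ∀ j, histogramWeight cell j₀ ε δ x' j ≤ histogramWeight cell j₀ ε δ x j +
      if p = j then (Real.exp ε - 1) * Real.exp (ε * cellCount cell x p) else 0 := by
    intro j
    unfold histogramWeight
    have h2 : Real.exp (ε * cellCount cell x' j) ≤ Real.exp (ε * cellCount cell x j) +
        if p = j then (Real.exp ε - 1) * Real.exp (ε * cellCount cell x p) else 0 := by
      have h3 : cellCount cell x' j ≤ cellCount cell x j + if p = j then 1 else 0 := by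
        have := hpq j
        have h4 : (0 : ℝ) ≤ if q = j then 1 else 0 := by split_ifs <;> norm_num
        linarith
      split_ifs with hp
      · subst hp
        rw [if_pos rfl] at h3
        calc Real.exp (ε * cellCount cell x' p) ≤ Real.exp (ε * (cellCount cell x p + 1)) := by
              gcongr
          _ = Real.exp ε * Real.exp (ε * cellCount cell x p) := by
              rw [← Real.exp_add]; congr 1; ring
          _ = _ := by ring
      · rw [if_neg hp, add_zero] at h3
        rw [add_zero]
        gcongr
    linarith
  have h5 := exp_cellCount_le_sum_histogramWeight cell j₀ hε hδ hδ1 x p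
  calc ∑ j, histogramWeight cell j₀ ε δ x' j
      ≤ ∑ j, histogramWeight cell j₀ ε δ x j +
          (Real.exp ε - 1) * Real.exp (ε * cellCount cell x p) := by
        refine (Finset.sum_le_sum fun j _ => h1 j).trans_eq ?_
        rw [Finset.sum_add_distrib]
        simp
    _ ≤ ∑ j, histogramWeight cell j₀ ε δ x j +
          (Real.exp ε - 1) * ∑ j, histogramWeight cell j₀ ε δ x j := by
        gcongr
    _ = _ := by ring

variable [MeasurableSpace ι] [DiscreteMeasurableSpace ι]

theorem measurable_histogramWeight {cell : ℝ → ι} (hcell : Measurable cell) (j₀ : ι) (ε δ : ℝ)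
    (j : ι) : Measurable fun x : Fin n → ℝ => histogramWeight cell j₀ ε δ x j := by
  unfold histogramWeight
  have := measurable_cellCount (n := n) hcell j
  fun_prop

/-- Selection of a populated cell without assumptions on the location of the data. -/
noncomputable def stableHistogram (n : ℕ) (cell : ℝ → ι) (j₀ : ι) (ε δ : ℝ) :
    Kernel (Fin n → ℝ) ι :=
  weightKernel (histogramWeight cell j₀ ε δ)

theorem stableHistogram_isMarkov {cell : ℝ → ι} (hcell : Measurable cell) (j₀ : ι) {ε δ : ℝ}
    (hε : 0 < ε) (hδ : 0 < δ) (hδ1 : δ < 1) : IsMarkovKernel (stableHistogram n cell j₀ ε δ) :=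
  weightKernel_isMarkov (measurable_histogramWeight hcell j₀ ε δ)
    (histogramWeight_nonneg cell j₀ hε hδ) (sum_histogramWeight_pos cell j₀ hε hδ hδ1)

/-- One factor `exp ε` comes from the weight and one from the normalization. The additive error `exp
ε - 1` at `p` is divided by a total of at least `exp ε / δ`, which leaves at most `δ`. -/
theorem Neighbours.dpDominated_stableHistogram {cell : ℝ → ι} (hcell : Measurable cell) (j₀ : ι)
    {ε δ : ℝ} (hε : 0 < ε) (hδ : 0 < δ) (hδ1 : δ < 1) {x x' : Fin n → ℝ} (h : Neighbours x x') :
    DPDominated (ENNReal.ofReal (Real.exp (2 * ε))) (ENNReal.ofReal δ)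
      (stableHistogram n cell j₀ ε δ x) (stableHistogram n cell j₀ ε δ x') := by
  obtain ⟨p, hp⟩ := h.histogramWeight_le cell j₀ hε hδ
  have he : 1 < Real.exp ε := Real.one_lt_exp_iff.2 hε
  have hZ := sum_histogramWeight_pos cell j₀ hε hδ hδ1 x
  have hZ' := sum_histogramWeight_pos cell j₀ hε hδ hδ1 x'
  have hZZ := h.sum_histogramWeight_le cell j₀ hε hδ hδ1
  refine dpDominated_weightKernel (measurable_histogramWeight hcell j₀ ε δ) (Real.exp_nonneg _)
    (η := fun j => if p = j then δ else 0) (fun j => by split_ifs <;> positivity) (by simp)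
    fun j => ?_
  have hK : Real.exp ε / δ ≤ ∑ j, histogramWeight cell j₀ ε δ x j := by
    have := le_sum_histogramWeight cell j₀ (δ := δ) hε x j₀
    have := exp_cellCount_sub_one_nonneg cell hε x j₀
    linarith
  set Z := ∑ j, histogramWeight cell j₀ ε δ x j
  set Z' := ∑ j, histogramWeight cell j₀ ε δ x' j
  have hw' := histogramWeight_nonneg cell j₀ hε hδ x' j
  have h1 : histogramWeight cell j₀ ε δ x' j / Z ≤
      Real.exp ε * (histogramWeight cell j₀ ε δ x' j / Z') := by
    rw [← mul_div_assoc, div_le_div_iff₀ hZ hZ', mul_comm (Real.exp ε), mul_assoc]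
    gcongr
  have h2 : (if p = j then Real.exp ε - 1 else 0) / Z ≤ if p = j then δ else 0 := by
    split_ifs
    · rw [div_le_iff₀ hZ]
      rw [div_le_iff₀ hδ] at hK
      linarith
    · simp
  calc histogramWeight cell j₀ ε δ x j / Z
      ≤ (Real.exp ε * histogramWeight cell j₀ ε δ x' j +
          if p = j then Real.exp ε - 1 else 0) / Z := by gcongr; exact hp j
    _ = Real.exp ε * (histogramWeight cell j₀ ε δ x' j / Z) +
          (if p = j then Real.exp ε - 1 else 0) / Z := by ring
    _ ≤ Real.exp ε * (Real.exp ε * (histogramWeight cell j₀ ε δ x' j / Z')) +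
          if p = j then δ else 0 := by gcongr
    _ = _ := by
        rw [two_mul, Real.exp_add]
        ring

/-- Superadditivity of `exp c - 1`: scattered points weigh no more than the same points in one cell,
so the number of cells does not enter. -/
theorem sum_exp_sub_one_le {κ : Type*} (s : Finset κ) (c : κ → ℝ) (hc : ∀ j, 0 ≤ c j) :
    ∑ j ∈ s, (Real.exp (c j) - 1) ≤ Real.exp (∑ j ∈ s, c j) - 1 := by
  classical
  induction s using Finset.induction_on with
  | empty => simp
  | insert j s hj ih =>
    rw [Finset.sum_insert hj, Finset.sum_insert hj, Real.exp_add]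
    have h1 := Real.one_le_exp (hc j)
    have h2 := Real.one_le_exp (Finset.sum_nonneg fun i (_ : i ∈ s) => hc i)
    nlinarith

/-- The bad cells weigh at most `exp (ε * n / 5) + exp ε / δ` in total, while the cell `g` forces a
total of at least `exp (2 * ε * n / 5)`. The assumption `5 ≤ n` gives `exp ε ≤ exp (ε * n / 5)`. -/
theorem stableHistogram_compl_le {cell : ℝ → ι} (hcell : Measurable cell) (j₀ : ι) {ε δ : ℝ}
    (hε : 0 < ε) (hδ : 0 < δ) (hδ1 : δ < 1) {x : Fin n → ℝ} {G : Finset ι} (hn : 5 ≤ n)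
    (hbad : ∑ j ∈ Gᶜ, cellCount cell x j ≤ n / 5) (hgood : ∃ g, 2 * n / 5 ≤ cellCount cell x g) :
    stableHistogram n cell j₀ ε δ x {j | j ∉ G} ≤
      ENNReal.ofReal (2 / δ * Real.exp (-(ε * n / 5))) := by
  obtain ⟨g, hg⟩ := hgood
  have hZ := sum_histogramWeight_pos cell j₀ hε hδ hδ1 x
  have hZg := exp_cellCount_le_sum_histogramWeight cell j₀ hε hδ hδ1 x g
  have hn' : (5 : ℝ) ≤ n := by exact_mod_cast hn
  have hS : MeasurableSet {j | j ∉ G} := MeasurableSet.of_discrete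
  have h1 : stableHistogram n cell j₀ ε δ x {j | j ∉ G} =
      ∑ j ∈ Gᶜ, ENNReal.ofReal (histogramWeight cell j₀ ε δ x j /
        ∑ l, histogramWeight cell j₀ ε δ x l) := by
    rw [← lintegral_indicator_one hS, stableHistogram,
      lintegral_weightKernel (measurable_histogramWeight hcell j₀ ε δ)]
    rw [← Finset.sum_subset (Finset.subset_univ Gᶜ)]
    · refine Finset.sum_congr rfl fun j hj => ?_
      rw [Set.indicator_of_mem (by simpa using hj)]
      simp
    · intro j _ hj
      rw [Set.indicator_of_notMem (by simpa using hj), mul_zero]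
  rw [h1, ← ENNReal.ofReal_sum_of_nonneg fun j _ =>
    div_nonneg (histogramWeight_nonneg cell j₀ hε hδ x j) hZ.le, ← Finset.sum_div]
  apply ENNReal.ofReal_le_ofReal
  have h2 : ∑ j ∈ Gᶜ, histogramWeight cell j₀ ε δ x j ≤
      Real.exp (ε * n / 5) + Real.exp ε / δ := by
    unfold histogramWeight
    rw [Finset.sum_add_distrib]
    have h3 : ∑ j ∈ Gᶜ, (Real.exp (ε * cellCount cell x j) - 1) ≤ Real.exp (ε * n / 5) - 1 := by
      refine (sum_exp_sub_one_le _ _ fun j =>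
        mul_nonneg hε.le (cellCount_nonneg cell x j)).trans ?_
      rw [← Finset.mul_sum, mul_div_assoc]
      gcongr
    have h4 : ∑ j ∈ Gᶜ, (if j₀ = j then Real.exp ε / δ else 0) ≤ Real.exp ε / δ := by
      rw [Finset.sum_ite_eq]
      split_ifs <;> [exact le_rfl; positivity]
    linarith
  have h5 : Real.exp (2 * (ε * n / 5)) ≤ ∑ j, histogramWeight cell j₀ ε δ x j := by
    refine le_trans ?_ hZg
    apply Real.exp_le_exp.2
    calc 2 * (ε * n / 5) = ε * (2 * n / 5) := by ring
      _ ≤ _ := by gcongr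
  have h6 : Real.exp ε / δ ≤ Real.exp (ε * n / 5) / δ := by
    gcongr
    nlinarith
  have h7 : Real.exp (ε * n / 5) ≤ Real.exp (ε * n / 5) / δ := by
    rw [le_div_iff₀ hδ]
    nlinarith [Real.exp_pos (ε * n / 5)]
  calc (∑ j ∈ Gᶜ, histogramWeight cell j₀ ε δ x j) / ∑ l, histogramWeight cell j₀ ε δ x l
      ≤ (2 * (Real.exp (ε * n / 5) / δ)) / Real.exp (2 * (ε * n / 5)) := by
        gcongr
        linarith
    _ = _ := by
        rw [two_mul (ε * n / 5), Real.exp_add, Real.exp_neg]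
        field_simp

end StableHistogram

/-! ### The noisy histogram for zero-concentrated differential privacy -/

section NoisyHistogram
variable {B n : ℕ}

/-- Taking the smallest maximizing index makes the choice measurable. -/
theorem exists_measurable_argmax (B : ℕ) :
    ∃ f : (Fin (B + 1) → ℝ) → Fin (B + 1), Measurable f ∧
      ∀ (z : Fin (B + 1) → ℝ) i, z i ≤ z (f z) := by
  classical
  have hp : ∀ z : Fin (B + 1) → ℝ, ∃ N, ∃ h : N < B + 1, ∀ i, z i ≤ z ⟨N, h⟩ := by
    intro z
    obtain ⟨j, -, hj⟩ := Finset.exists_max_image Finset.univ z ⟨0, Finset.mem_univ _⟩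
    exact ⟨j, j.2, fun i => hj i (Finset.mem_univ i)⟩
  refine ⟨fun z => ⟨Nat.find (hp z), (Nat.find_spec (hp z)).1⟩, ?_,
    fun z => (Nat.find_spec (hp z)).2⟩
  have hm : Measurable fun z => Nat.find (hp z) := by
    refine measurable_find hp fun N => ?_
    by_cases hN : N < B + 1
    · simp only [hN, exists_true_left]
      have : {z : Fin (B + 1) → ℝ | ∀ i, z i ≤ z ⟨N, hN⟩} = ⋂ i, {z | z i ≤ z ⟨N, hN⟩} := by
        ext z; simp
      rw [this]
      exact MeasurableSet.iInter fun i =>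
        measurableSet_le (measurable_pi_apply _) (measurable_pi_apply _)
    · simp [hN]
  refine measurable_to_countable' fun j => ?_
  have := hm (measurableSet_singleton j.1)
  convert this using 1
  ext z
  simp [Fin.ext_iff]

/-- A measurable choice of the position of the largest coordinate. -/
noncomputable def argmax (z : Fin (B + 1) → ℝ) : Fin (B + 1) :=
  (exists_measurable_argmax B).choose z

theorem measurable_argmax : Measurable (argmax (B := B)) :=
  (exists_measurable_argmax B).choose_spec.1

theorem le_argmax (z : Fin (B + 1) → ℝ) (i : Fin (B + 1)) : z i ≤ z (argmax z) :=
  (exists_measurable_argmax B).choose_spec.2 z i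

/-- The cell with the largest count after the addition of Gaussian noise of variance `v`. -/
noncomputable def noisyHistogram (n : ℕ) (cell : ℝ → Fin (B + 1)) (v : NNReal) :
    Kernel (Fin n → ℝ) (Fin (B + 1)) :=
  noiseKernel (Measure.pi fun _ : Fin (B + 1) => gaussianReal 0 v)
    fun p => argmax fun j => cellCount cell p.1 j + p.2 j

theorem measurable_add_cellCount {cell : ℝ → Fin (B + 1)} (hcell : Measurable cell) :
    Measurable fun p : (Fin n → ℝ) × (Fin (B + 1) → ℝ) => fun j => cellCount cell p.1 j + p.2 j :=
  measurable_pi_lambda _ fun j => ((measurable_cellCount hcell j).comp measurable_fst).add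
    ((measurable_pi_apply j).comp measurable_snd)

theorem measurable_argmax_add_cellCount {cell : ℝ → Fin (B + 1)} (hcell : Measurable cell) :
    Measurable fun p : (Fin n → ℝ) × (Fin (B + 1) → ℝ) =>
      argmax fun j => cellCount cell p.1 j + p.2 j :=
  measurable_argmax.comp (measurable_add_cellCount hcell)

theorem noisyHistogram_isMarkov {cell : ℝ → Fin (B + 1)} (hcell : Measurable cell) (v : NNReal) :
    IsMarkovKernel (noisyHistogram n cell v) :=
  noiseKernel_isMarkov _ (measurable_argmax_add_cellCount hcell)

theorem map_add_pi_gaussianReal {ι : Type*} [Fintype ι] (m : ι → ℝ) (v : NNReal) :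
    (Measure.pi fun _ : ι => gaussianReal 0 v).map (fun z j => m j + z j) =
      Measure.pi fun j => gaussianReal (m j) v := by
  rw [Measure.pi_map_pi fun j => by fun_prop]
  simp_rw [gaussianReal_map_const_add, zero_add]

/-- The vector of counts has squared `ℓ²` sensitivity at most 2, which gives `2 / (2 * v)`; the
argmax is post-processing. -/
theorem Neighbours.renyiDominated_noisyHistogram {cell : ℝ → Fin (B + 1)}
    (hcell : Measurable cell) {v : NNReal} (hv : v ≠ 0) {a : ℝ} (ha : 1 < a)
    {x x' : Fin n → ℝ} (h : Neighbours x x') :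
    RenyiDominated a (1 / v) (noisyHistogram n cell v x) (noisyHistogram n cell v x') := by
  have hv' : (0 : ℝ) < v := NNReal.coe_pos.2 (pos_iff_ne_zero.2 hv)
  have key : ∀ y : Fin n → ℝ, noisyHistogram n cell v y =
      (Measure.pi fun j => gaussianReal (cellCount cell y j) v).map argmax := by
    intro y
    unfold noisyHistogram
    rw [noiseKernel_apply _ (measurable_argmax_add_cellCount hcell),
      ← map_add_pi_gaussianReal (cellCount cell y), Measure.map_map measurable_argmax (by fun_prop)]
    rfl
  rw [key, key]
  refine RenyiDominated.map (RenyiDominated.mono ha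
    (RenyiDominated.pi ha fun j => renyiDominated_gaussianReal hv ha) ?_) measurable_argmax
  rw [← Finset.sum_div, div_le_div_iff₀ (by positivity) hv']
  nlinarith [h.sum_sq_cellCount_le cell]

/-- A bad cell has count at most `n / 5` and the cell `g` at least `2 * n / 5`, so a bad cell wins
only if some noise reaches half the gap, `n / 10`. -/
theorem noisyHistogram_compl_le {cell : ℝ → Fin (B + 1)} (hcell : Measurable cell) {v : NNReal}
    (hv : v ≠ 0) {x : Fin n → ℝ} {G : Finset (Fin (B + 1))}
    (hbad : ∑ j ∈ Gᶜ, cellCount cell x j ≤ n / 5) (hgood : ∃ g, 2 * n / 5 ≤ cellCount cell x g) :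
    noisyHistogram n cell v x {j | j ∉ G} ≤
      ENNReal.ofReal ((B + 1) * (2 * Real.exp (-((n / 10) ^ 2 / (2 * v))))) := by
  obtain ⟨g, hg⟩ := hgood
  have hS : MeasurableSet {j | j ∉ G} := MeasurableSet.of_discrete
  have hm : Measurable fun z : Fin (B + 1) → ℝ => argmax fun j => cellCount cell x j + z j :=
    (measurable_argmax_add_cellCount hcell).comp measurable_prodMk_left
  unfold noisyHistogram
  rw [noiseKernel_apply _ (measurable_argmax_add_cellCount hcell), Measure.map_apply hm hS]
  have hsub : (fun z => argmax fun j => cellCount cell x j + z j) ⁻¹' {j | j ∉ G} ⊆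
      ⋃ j : Fin (B + 1), (fun z : Fin (B + 1) → ℝ => z j) ⁻¹' {t | (n : ℝ) / 10 ≤ |t|} := by
    intro z hz
    by_contra hne
    simp only [Set.mem_iUnion, Set.mem_preimage, Set.mem_ofPred_eq, not_exists, not_le] at hne hz
    set k := argmax fun j => cellCount cell x j + z j with hk
    have h1 : cellCount cell x g + z g ≤ cellCount cell x k + z k :=
      le_argmax (fun j => cellCount cell x j + z j) g
    have h2 : cellCount cell x k ≤ n / 5 :=
      (Finset.single_le_sum (fun j _ => cellCount_nonneg cell x j)
        (Finset.mem_compl.2 hz)).trans hbad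
    have h3 := (abs_lt.1 (hne g)).1
    have h4 := (abs_lt.1 (hne k)).2
    linarith
  calc _ ≤ _ := measure_mono hsub
    _ ≤ _ := measure_iUnion_fintype_le _ _
    _ ≤ ∑ _j : Fin (B + 1), ENNReal.ofReal (2 * Real.exp (-((n / 10) ^ 2 / (2 * v)))) := by
        refine Finset.sum_le_sum fun j _ => ?_
        have hT : MeasurableSet {t : ℝ | (n : ℝ) / 10 ≤ |t|} :=
          measurableSet_le measurable_const (by fun_prop)
        rw [(measurePreserving_eval (fun _ : Fin (B + 1) => gaussianReal 0 v) j).measure_preimage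
          hT.nullMeasurableSet]
        exact gaussianReal_abs_ge_le hv (by positivity)
    _ = _ := by
        rw [Finset.sum_const, Finset.card_univ, Fintype.card_fin, nsmul_eq_mul,
          ← ENNReal.ofReal_natCast, ← ENNReal.ofReal_mul (by positivity), Nat.cast_add,
          Nat.cast_one]

end NoisyHistogram

/-! ### Bernstein-type concentration -/

section Concentration
variable {n : ℕ} {D : Measure ℝ} [IsProbabilityMeasure D]

theorem integrable_of_abs_sub_le {f : ℝ → ℝ} (hf : Measurable f) {m b : ℝ}
    (hb : ∀ x, |f x - m| ≤ b) : Integrable f D := by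
  refine Integrable.of_bound hf.aestronglyMeasurable (b + |m|)
    (Filter.Eventually.of_forall fun x => ?_)
  have := abs_add_le (f x - m) m
  rw [sub_add_cancel] at this
  rw [Real.norm_eq_abs]
  linarith [hb x]

/-- For `|u| ≤ 1`, `exp u ≤ 1 + u + u ^ 2`; the linear term has mean zero. -/
theorem integral_exp_mul_sub_le {f : ℝ → ℝ} (hf : Measurable f) {b s : ℝ}
    (hb : ∀ x, |f x - ∫ y, f y ∂D| ≤ b) (hvar : ∫ x, (f x - ∫ y, f y ∂D) ^ 2 ∂D ≤ 2)
    (hs : 0 ≤ s) (hsb : s * b ≤ 1) :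
    ∫ x, Real.exp (s * (f x - ∫ y, f y ∂D)) ∂D ≤ Real.exp (2 * s ^ 2) := by
  set m := ∫ y, f y ∂D with hm
  have hfi : Integrable f D := integrable_of_abs_sub_le hf hb
  have hg : Integrable (fun x => f x - m) D := hfi.sub (integrable_const m)
  have hg2 : Integrable (fun x => (f x - m) ^ 2) D := by
    refine Integrable.of_bound (by fun_prop) (b ^ 2) (Filter.Eventually.of_forall fun x => ?_)
    rw [Real.norm_eq_abs, abs_pow]
    exact pow_le_pow_left₀ (abs_nonneg _) (hb x) 2
  have h0 : ∫ x, (f x - m) ∂D = 0 := by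
    rw [integral_sub hfi (integrable_const m)]
    simp [hm]
  calc ∫ x, Real.exp (s * (f x - m)) ∂D
      ≤ ∫ x, (1 + s * (f x - m) + s ^ 2 * (f x - m) ^ 2) ∂D := by
        refine integral_mono_of_nonneg (Filter.Eventually.of_forall fun x => Real.exp_nonneg _)
          (((integrable_const 1).add (hg.const_mul s)).add (hg2.const_mul _))
          (Filter.Eventually.of_forall fun x => ?_)
        have h1 : |s * (f x - m)| ≤ 1 := by
          rw [abs_mul, abs_of_nonneg hs]
          exact (mul_le_mul_of_nonneg_left (hb x) hs).trans hsb
        have h2 := (abs_le.1 (Real.abs_exp_sub_one_sub_id_le h1)).2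
        simp only
        nlinarith
    _ = 1 + s ^ 2 * ∫ x, (f x - m) ^ 2 ∂D := by
        have h1 : Integrable (fun x => 1 + s * (f x - m)) D :=
          (integrable_const 1).add (hg.const_mul s)
        rw [integral_add h1 (hg2.const_mul _), integral_add (integrable_const 1) (hg.const_mul s), integral_const_mul, integral_const_mul, h0]
        simp
    _ ≤ 2 * s ^ 2 + 1 := by nlinarith [sq_nonneg s]
    _ ≤ _ := Real.add_one_le_exp _

/-- Chernoff bound at `s = θ * t`, with exponent `-n * θ * t ^ 2 * (1 - 2 * θ)`; `θ ≤ 1 / 4` makes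
the bracket at least `1 / 2`. The free `θ` lets the caller satisfy `s * b ≤ 1`. -/
theorem measure_sum_sub_ge_le {f : ℝ → ℝ} (hf : Measurable f) {b t θ : ℝ}
    (hb : ∀ x, |f x - ∫ y, f y ∂D| ≤ b) (hvar : ∫ x, (f x - ∫ y, f y ∂D) ^ 2 ∂D ≤ 2)
    (hθ : 0 ≤ θ) (hθ1 : θ ≤ 1 / 4) (ht : 0 ≤ t) (htb : θ * t * b ≤ 1) :
    (Measure.pi fun _ : Fin n => D) {x | n * t ≤ ∑ i, (f (x i) - ∫ y, f y ∂D)} ≤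
      ENNReal.ofReal (Real.exp (-(n * θ * t ^ 2 / 2))) := by
  set m := ∫ y, f y ∂D with hm
  set P := Measure.pi fun _ : Fin n => D
  have hst : 0 ≤ θ * t := by positivity
  have hint : Integrable (fun x : Fin n → ℝ => Real.exp (θ * t * ∑ i, (f (x i) - m))) P := by
    have hm : Measurable fun x : Fin n → ℝ => Real.exp (θ * t * ∑ i, (f (x i) - m)) := by fun_prop
    refine Integrable.of_bound hm.aestronglyMeasurable (Real.exp (θ * t * (n * b)))
      (Filter.Eventually.of_forall fun x => ?_)
    rw [Real.norm_eq_abs, Real.abs_exp]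
    apply Real.exp_le_exp.2
    gcongr
    calc ∑ i, (f (x i) - m) ≤ ∑ _i : Fin n, b :=
          Finset.sum_le_sum fun i _ => (le_abs_self _).trans (hb _)
      _ = n * b := by simp
  have hmgf : mgf (fun x : Fin n → ℝ => ∑ i, (f (x i) - m)) P (θ * t) ≤
      Real.exp (n * (2 * (θ * t) ^ 2)) := by
    unfold mgf
    simp_rw [Finset.mul_sum, Real.exp_sum]
    rw [integral_fintype_prod_eq_prod (fun (_ : Fin n) y => Real.exp (θ * t * (f y - m)))]
    rw [Finset.prod_const, Finset.card_univ, Fintype.card_fin, Real.exp_nat_mul]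
    exact pow_le_pow_left₀ (integral_nonneg fun x => (Real.exp_pos _).le)
      (integral_exp_mul_sub_le hf hb hvar hst htb) n
  rw [← ofReal_measureReal]
  apply ENNReal.ofReal_le_ofReal
  refine (measure_ge_le_exp_mul_mgf (n * t) hst hint).trans ?_
  calc _ ≤ Real.exp (-(θ * t) * (n * t)) * Real.exp (n * (2 * (θ * t) ^ 2)) := by gcongr
    _ ≤ _ := by
      rw [← Real.exp_add]
      apply Real.exp_le_exp.2
      have h1 : 0 ≤ n * θ * t ^ 2 := by positivity
      have h2 : n * θ * t ^ 2 * θ ≤ n * θ * t ^ 2 * (1 / 4) := by gcongr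
      nlinarith

theorem measure_abs_sum_sub_ge_le {f : ℝ → ℝ} (hf : Measurable f) {b t θ : ℝ}
    (hb : ∀ x, |f x - ∫ y, f y ∂D| ≤ b) (hvar : ∫ x, (f x - ∫ y, f y ∂D) ^ 2 ∂D ≤ 2)
    (hθ : 0 ≤ θ) (hθ1 : θ ≤ 1 / 4) (ht : 0 ≤ t) (htb : θ * t * b ≤ 1) :
    (Measure.pi fun _ : Fin n => D) {x | n * t ≤ |∑ i, (f (x i) - ∫ y, f y ∂D)|} ≤
      ENNReal.ofReal (2 * Real.exp (-(n * θ * t ^ 2 / 2))) := by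
  have h1 := measure_sum_sub_ge_le (n := n) hf hb hvar hθ hθ1 ht htb
  have h2 := measure_sum_sub_ge_le (n := n) (D := D) (f := fun x => -f x) (b := b) hf.neg
    (fun x => by
      rw [integral_neg, ← neg_sub', abs_neg]
      exact hb x)
    (by
      rw [integral_neg]
      refine le_trans (le_of_eq ?_) hvar
      refine integral_congr_ae (Filter.Eventually.of_forall fun x => ?_)
      simp only
      ring) hθ hθ1 ht htb
  calc _ ≤ (Measure.pi fun _ : Fin n => D) ({x | n * t ≤ ∑ i, (f (x i) - ∫ y, f y ∂D)} ∪
        {x | n * t ≤ ∑ i, (-f (x i) - ∫ y, -f y ∂D)}) := by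
        refine measure_mono fun x hx => ?_
        rcases le_abs.1 (show n * t ≤ |∑ i, (f (x i) - ∫ y, f y ∂D)| from hx) with h | h
        · exact Or.inl h
        · refine Or.inr ?_
          simp only [Set.mem_ofPred_eq, integral_neg]
          refine h.trans_eq ?_
          rw [← Finset.sum_neg_distrib]
          exact Finset.sum_congr rfl fun i _ => by ring
    _ ≤ _ := measure_union_le _ _
    _ ≤ _ := add_le_add h1 h2
    _ = _ := by rw [← ENNReal.ofReal_add (Real.exp_nonneg _) (Real.exp_nonneg _), two_mul]

theorem integral_sub_sq_le {f : ℝ → ℝ} (hf : Integrable f D) {a : ℝ}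
    (hfa : Integrable (fun x => (f x - a) ^ 2) D) :
    ∫ x, (f x - ∫ y, f y ∂D) ^ 2 ∂D ≤ ∫ x, (f x - a) ^ 2 ∂D := by
  set m := ∫ y, f y ∂D with hm
  have h1 : ∀ x, (f x - m) ^ 2 = (f x - a) ^ 2 - (2 * (m - a)) * (f x - m) - (m - a) ^ 2 := by
    intro x; ring
  have h0 : ∫ x, (f x - m) ∂D = 0 := by
    rw [integral_sub hf (integrable_const m)]
    simp [hm]
  have hg : Integrable (fun x => f x - m) D := hf.sub (integrable_const m)
  have h2 : Integrable (fun x => (f x - a) ^ 2 - 2 * (m - a) * (f x - m)) D :=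
    hfa.sub (hg.const_mul _)
  simp_rw [h1]
  rw [integral_sub h2 (integrable_const _),
    integral_sub hfa (hg.const_mul _), integral_const_mul, h0]
  simp only [mul_zero, sub_zero, integral_const, probReal_univ, one_smul, tsub_le_iff_right,
    le_add_iff_nonneg_right]
  positivity

end Concentration

/-! ### Clipping and the clipped mean -/

section Clip

/-- Projection to the interval `[-T, T]`. -/
def clip (T u : ℝ) : ℝ := max (-T) (min T u)

theorem measurable_clip (T : ℝ) : Measurable (clip T) := by
  unfold clip; fun_prop

theorem abs_clip_le {T : ℝ} (hT : 0 ≤ T) (u : ℝ) : |clip T u| ≤ T := by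
  unfold clip
  rw [abs_le]
  exact ⟨le_max_left _ _, max_le (by linarith) (min_le_left _ _)⟩

theorem abs_clip_sub_clip_le (T u v : ℝ) : |clip T u - clip T v| ≤ |u - v| := by
  unfold clip
  refine (abs_max_sub_max_le_max _ _ _ _).trans ?_
  rw [sub_self, abs_zero]
  refine max_le (abs_nonneg _) ((abs_min_sub_min_le_max _ _ _ _).trans ?_)
  rw [sub_self, abs_zero]
  exact max_le (abs_nonneg _) le_rfl

theorem abs_clip_sub_self_le {T : ℝ} (hT : 0 ≤ T) (u : ℝ) : |clip T u - u| ≤ max 0 (|u| - T) := by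
  unfold clip
  rcases le_total u T with h | h
  · rw [min_eq_right h]
    rcases le_total (-T) u with h' | h'
    · rw [max_eq_right h', sub_self, abs_zero]; exact le_max_left _ _
    · rw [max_eq_left h', abs_of_nonneg (by linarith), abs_of_nonpos (by linarith)]
      exact le_max_of_le_right (by linarith)
  · rw [min_eq_left h, max_eq_right (by linarith), abs_of_nonpos (by linarith),
      abs_of_nonneg (by linarith)]
    exact le_max_of_le_right (by linarith)

/-- The mean of the data after clipping to `[c - T, c + T]`. -/
noncomputable def clippedMean {n : ℕ} (T c : ℝ) (x : Fin n → ℝ) : ℝ :=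
  c + (∑ i, clip T (x i - c)) / n

theorem measurable_clippedMean {n : ℕ} (T c : ℝ) :
    Measurable (clippedMean T c : (Fin n → ℝ) → ℝ) := by
  unfold clippedMean
  have := measurable_clip T
  fun_prop

theorem Neighbours.abs_clippedMean_sub_le {n : ℕ} {T : ℝ} (hT : 0 ≤ T) (c : ℝ)
    {x x' : Fin n → ℝ} (h : Neighbours x x') :
    |clippedMean T c x - clippedMean T c x'| ≤ 2 * T / n := by
  obtain ⟨i, hi⟩ := h.sum_sub_sum
  unfold clippedMean
  have h1 := hi fun t => clip T (t - c)
  rw [add_sub_add_left_eq_sub, ← sub_div, abs_div, Nat.abs_cast]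
  gcongr
  rw [h1]
  have h2 := abs_le.1 (abs_clip_le hT (x i - c))
  have h3 := abs_le.1 (abs_clip_le hT (x' i - c))
  rw [abs_le]
  constructor <;> linarith

end Clip

/-! ### Bias, variance and tails under the moment bound -/

section Moments
variable {D : Measure ℝ} [IsProbabilityMeasure D] {μ k : ℝ}

theorem sq_le_one_add_rpow {z : ℝ} (hz : 0 ≤ z) (hk : 2 ≤ k) : z ^ 2 ≤ 1 + z ^ k := by
  rcases le_total z 1 with h | h
  · have h1 : z ^ 2 ≤ 1 := pow_le_one₀ hz h
    have h2 := Real.rpow_nonneg hz k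
    linarith
  · have : z ^ (2 : ℝ) ≤ z ^ k := Real.rpow_le_rpow_of_exponent_le h hk
    rw [Real.rpow_two] at this
    linarith

theorem HasMeanAndMoment.integrable_sq (h : HasMeanAndMoment D μ k 1) (hk : 2 ≤ k) :
    Integrable (fun x => (x - μ) ^ 2) D := by
  refine ((integrable_const (1 : ℝ)).add h.2.2.1).mono' (by fun_prop)
    (Filter.Eventually.of_forall fun x => ?_)
  rw [Real.norm_eq_abs, abs_pow]
  exact sq_le_one_add_rpow (abs_nonneg _) hk

theorem HasMeanAndMoment.integral_sq_le (h : HasMeanAndMoment D μ k 1) (hk : 2 ≤ k) :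
    ∫ x, (x - μ) ^ 2 ∂D ≤ 2 := by
  calc ∫ x, (x - μ) ^ 2 ∂D ≤ ∫ x, (1 + |x - μ| ^ k) ∂D := by
        refine integral_mono (h.integrable_sq hk) ((integrable_const (1 : ℝ)).add h.2.2.1)
          fun x => ?_
        simp only
        rw [← sq_abs]
        exact sq_le_one_add_rpow (abs_nonneg _) hk
    _ = 1 + ∫ x, |x - μ| ^ k ∂D := by
        rw [integral_add (integrable_const _) h.2.2.1]; simp
    _ ≤ 2 := by linarith [h.2.2.2]

/-- If `|x - μ| ≤ 4 * A` then `|x - c| ≤ 4 * A + 12 ≤ 16 * A` and nothing is clipped. Otherwise the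
clipping error is at most `|x - μ|`, and `|x - μ| ^ (k - 1) ≥ (4 * A) ^ (k - 1) ≥ 4 / α` bounds it
by `α / 4 * |x - μ| ^ k`. -/
theorem HasMeanAndMoment.abs_clip_bias_le (h : HasMeanAndMoment D μ k 1) (hk : 2 ≤ k) {A α c : ℝ}
    (hα : 0 < α) (hA : 1 ≤ A) (hAα : A ^ (k - 1) = 1 / α) (hc : |c - μ| ≤ 12) :
    |c + ∫ x, clip (16 * A) (x - c) ∂D - μ| ≤ α / 4 := by
  have hT : 0 ≤ 16 * A := by linarith
  have hi1 : Integrable (fun x => clip (16 * A) (x - c)) D :=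
    Integrable.of_bound (((measurable_clip _).comp (by fun_prop)).aestronglyMeasurable) (16 * A)
      (Filter.Eventually.of_forall fun x => abs_clip_le hT _)
  have hi2 : Integrable (fun x => x - c) D := h.1.sub (integrable_const c)
  have h1 : c + ∫ x, clip (16 * A) (x - c) ∂D - μ =
      ∫ x, (clip (16 * A) (x - c) - (x - c)) ∂D := by
    rw [integral_sub hi1 hi2, integral_sub h.1 (integrable_const c), h.2.1]
    simp
    ring
  rw [h1]
  calc |∫ x, (clip (16 * A) (x - c) - (x - c)) ∂D|
      ≤ ∫ x, |clip (16 * A) (x - c) - (x - c)| ∂D := abs_integral_le_integral_abs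
    _ ≤ ∫ x, (α / 4) * |x - μ| ^ k ∂D := by
        refine integral_mono (hi1.sub hi2).abs (h.2.2.1.const_mul _) fun x => ?_
        have hz : 0 ≤ |x - μ| := abs_nonneg _
        refine (abs_clip_sub_self_le hT _).trans (max_le (by positivity) ?_)
        have h2 : |x - c| ≤ |x - μ| + 12 := by
          have := abs_sub_le x μ c
          rw [abs_sub_comm μ c] at this
          linarith
        rcases le_total |x - μ| (4 * A) with h3 | h3
        · have : 0 ≤ α / 4 * |x - μ| ^ k := by positivity
          linarith
        · have h4 : 4 / α ≤ |x - μ| ^ (k - 1) := by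
            calc 4 / α = 4 ^ (1 : ℝ) * A ^ (k - 1) := by
                  rw [hAα, Real.rpow_one]; ring
              _ ≤ 4 ^ (k - 1) * A ^ (k - 1) := by
                  have : (4 : ℝ) ^ (1 : ℝ) ≤ 4 ^ (k - 1) :=
                    Real.rpow_le_rpow_of_exponent_le (by norm_num) (by linarith)
                  have := Real.rpow_nonneg (show 0 ≤ A by linarith) (k - 1)
                  gcongr
              _ = (4 * A) ^ (k - 1) := (Real.mul_rpow (by norm_num) (by linarith)).symm
              _ ≤ _ := Real.rpow_le_rpow (by linarith) h3 (by linarith)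
          have hz0 : 0 < |x - μ| := by linarith
          have h5 : |x - μ| ^ k = |x - μ| * |x - μ| ^ (k - 1) := by
            rw [← Real.rpow_one_add' hz (by linarith)]
            congr 1; ring
          calc |x - c| - 16 * A ≤ |x - μ| := by linarith
            _ = α / 4 * (|x - μ| * (4 / α)) := by field_simp
            _ ≤ _ := by
              rw [h5]
              gcongr
    _ ≤ α / 4 := by
        rw [integral_const_mul]
        have := h.2.2.2
        nlinarith

/-- Clipping is 1-Lipschitz, and the variance is at most the second moment about any point, here the
clipped image of `μ`. -/
theorem HasMeanAndMoment.clip_variance_le (h : HasMeanAndMoment D μ k 1) (hk : 2 ≤ k) {T : ℝ}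
    (hT : 0 ≤ T) (c : ℝ) :
    ∫ x, (clip T (x - c) - ∫ y, clip T (y - c) ∂D) ^ 2 ∂D ≤ 2 := by
  have hm : Measurable fun x => clip T (x - c) := (measurable_clip _).comp (by fun_prop)
  have hi1 : Integrable (fun x => clip T (x - c)) D :=
    Integrable.of_bound hm.aestronglyMeasurable T
      (Filter.Eventually.of_forall fun x => abs_clip_le hT _)
  have hle : ∀ x, (clip T (x - c) - clip T (μ - c)) ^ 2 ≤ (x - μ) ^ 2 := by
    intro x
    apply sq_le_sq.2
    refine (abs_clip_sub_clip_le _ _ _).trans_eq ?_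
    congr 1; ring
  have hi2 : Integrable (fun x => (clip T (x - c) - clip T (μ - c)) ^ 2) D := by
    refine (h.integrable_sq hk).mono' ((hm.sub_const _).pow_const 2).aestronglyMeasurable
      (Filter.Eventually.of_forall fun x => ?_)
    rw [Real.norm_eq_abs, abs_of_nonneg (sq_nonneg _)]
    exact hle x
  exact (integral_sub_sq_le hi1 hi2).trans
    ((integral_mono hi2 (h.integrable_sq hk) hle).trans (h.integral_sq_le hk))

theorem HasMeanAndMoment.measure_clippedMean_le (h : HasMeanAndMoment D μ k 1) (hk : 2 ≤ k)
    {n : ℕ} (hn : 0 < n) {A α c : ℝ} (hα : 0 < α) (hA : 1 ≤ A) (hAα : A ^ (k - 1) = 1 / α)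
    (hαA : α * A ≤ 1) (hc : |c - μ| ≤ 12) :
    (Measure.pi fun _ : Fin n => D) {x | α / 2 < |clippedMean (16 * A) c x - μ|} ≤
      ENNReal.ofReal (2 * Real.exp (-(n * α ^ 2 / 256))) := by
  have hT : 0 ≤ 16 * A := by linarith
  have hm : Measurable fun x => clip (16 * A) (x - c) := (measurable_clip _).comp (by fun_prop)
  have hmean : |∫ y, clip (16 * A) (y - c) ∂D| ≤ 16 * A := by
    have := norm_integral_le_of_norm_le_const (μ := D) (C := 16 * A)
      (f := fun y => clip (16 * A) (y - c))
      (Filter.Eventually.of_forall fun y => abs_clip_le hT (y - c))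
    simpa using this
  have hb : ∀ x, |clip (16 * A) (x - c) - ∫ y, clip (16 * A) (y - c) ∂D| ≤ 32 * A := by
    intro x
    have := abs_sub (clip (16 * A) (x - c)) (∫ y, clip (16 * A) (y - c) ∂D)
    have := abs_clip_le hT (x - c)
    linarith
  -- With `b = 32 * A` these values give `θ * t * b = α * A ≤ 1`.
  have key := measure_abs_sum_sub_ge_le (n := n) (D := D) (t := α / 4) (θ := 1 / 8) hm hb
    (h.clip_variance_le hk hT c) (by norm_num) (by norm_num) (by positivity) (by nlinarith)
  have hbias := h.abs_clip_bias_le hk hα hA hAα hc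
  have hn' : (0 : ℝ) < n := by exact_mod_cast hn
  refine (measure_mono fun x hx => ?_).trans (key.trans_eq ?_)
  · simp only [Set.mem_ofPred_eq] at hx ⊢
    by_contra hlt
    rw [not_le] at hlt
    have h1 : clippedMean (16 * A) c x - μ = (c + ∫ y, clip (16 * A) (y - c) ∂D - μ) +
        (∑ i, (clip (16 * A) (x i - c) - ∫ y, clip (16 * A) (y - c) ∂D)) / n := by
      unfold clippedMean
      rw [Finset.sum_sub_distrib]
      simp
      field_simp
      ring
    rw [h1] at hx
    have h2 := abs_add_le (c + ∫ y, clip (16 * A) (y - c) ∂D - μ)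
      ((∑ i, (clip (16 * A) (x i - c) - ∫ y, clip (16 * A) (y - c) ∂D)) / n)
    have h3 : |(∑ i, (clip (16 * A) (x i - c) - ∫ y, clip (16 * A) (y - c) ∂D)) / n| ≤ α / 4 := by
      rw [abs_div, Nat.abs_cast, div_le_iff₀ hn']
      linarith
    linarith
  · congr 4
    ring

/-- By Chebyshev a point is farther than 4 from `μ` with probability at most `2 / 16`; a deviation
of `1 / 16` in the empirical frequency stays below `1 / 5`. -/
theorem HasMeanAndMoment.measure_far_le (h : HasMeanAndMoment D μ k 1) (hk : 2 ≤ k) (n : ℕ) :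
    (Measure.pi fun _ : Fin n => D)
        {x | (n : ℝ) / 5 < ∑ i, if |x i - μ| ≤ 4 then (0 : ℝ) else 1} ≤
      ENNReal.ofReal (2 * Real.exp (-(n / 4096))) := by
  set f : ℝ → ℝ := fun t => if |t - μ| ≤ 4 then 0 else 1 with hf
  have hm : Measurable f :=
    Measurable.ite (measurableSet_le (by fun_prop) measurable_const) measurable_const
      measurable_const
  have hf0 : ∀ t, 0 ≤ f t := fun t => by simp only [hf]; split_ifs <;> norm_num
  have hf1 : ∀ t, f t ≤ 1 := fun t => by simp only [hf]; split_ifs <;> norm_num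
  have hfi : Integrable f D := Integrable.of_bound hm.aestronglyMeasurable 1
    (Filter.Eventually.of_forall fun t => by
      rw [Real.norm_eq_abs, abs_of_nonneg (hf0 t)]; exact hf1 t)
  have hmean : ∫ t, f t ∂D ≤ 1 / 8 := by
    calc ∫ t, f t ∂D ≤ ∫ t, (1 / 16) * (t - μ) ^ 2 ∂D := by
          refine integral_mono hfi ((h.integrable_sq hk).const_mul _) fun t => ?_
          simp only [hf]
          split_ifs with ht
          · positivity
          · rw [← sq_abs]
            nlinarith
      _ ≤ 1 / 8 := by
          rw [integral_const_mul]
          linarith [h.integral_sq_le hk]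
  have hmean0 : 0 ≤ ∫ t, f t ∂D := integral_nonneg hf0
  have hb : ∀ t, |f t - ∫ y, f y ∂D| ≤ 1 := by
    intro t
    rw [abs_le]
    constructor <;> linarith [hf0 t, hf1 t]
  have hvar : ∫ t, (f t - ∫ y, f y ∂D) ^ 2 ∂D ≤ 2 := by
    have hle : ∀ t, (f t - ∫ y, f y ∂D) ^ 2 ≤ 1 := fun t => by
      rw [← sq_abs]; exact pow_le_one₀ (abs_nonneg _) (hb t)
    have := norm_integral_le_of_norm_le_const (μ := D) (C := 1)
      (Filter.Eventually.of_forall fun t => by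
        rw [Real.norm_eq_abs, abs_of_nonneg (sq_nonneg _)]; exact hle t)
    have := (le_abs_self _).trans this
    simp only [probReal_univ, mul_one] at this
    linarith
  have key := measure_abs_sum_sub_ge_le (n := n) (D := D) (t := 1 / 16) (θ := 1 / 8) hm hb
    hvar (by norm_num) (by norm_num) (by norm_num) (by norm_num)
  refine (measure_mono fun x hx => ?_).trans (key.trans_eq ?_)
  · simp only [Set.mem_ofPred_eq] at hx ⊢
    refine le_trans ?_ (le_abs_self _)
    rw [Finset.sum_sub_distrib]
    have hx' : (n : ℝ) / 5 < ∑ i, f (x i) := hx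
    have h2 : (n : ℝ) * ∫ y, f y ∂D ≤ n * (1 / 8) := by gcongr
    simp only [Finset.sum_const, Finset.card_univ, Fintype.card_fin, nsmul_eq_mul]
    have h3 : (0 : ℝ) ≤ n := by positivity
    linarith
  · congr 4
    ring

end Moments

/-! ### The grid of coarse cells -/

section Grid

/-- The cell of width `8` which contains `x`, in a partition of the range of the data. -/
noncomputable def gridCell (R : ℝ) (B : ℕ) (x : ℝ) : Fin (B + 1) :=
  ⟨min ⌊(x + R + 4) / 8⌋₊ B, by omega⟩

/-- The left end of a cell. -/
def gridPoint (R : ℝ) {B : ℕ} (j : Fin (B + 1)) : ℝ := 8 * (j : ℕ) - R - 4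

theorem measurable_gridCell (R : ℝ) (B : ℕ) : Measurable (gridCell R B) := by
  have h1 : Measurable fun x : ℝ => ⌊(x + R + 4) / 8⌋₊ := Nat.measurable_floor.comp (by fun_prop)
  have h2 : Measurable fun i : ℕ => (⟨min i B, by omega⟩ : Fin (B + 1)) := Measurable.of_discrete
  exact h2.comp h1

/-- The interval `[μ - 4, μ + 4]` has the length of one cell, so it meets only the cell of `μ - 4`
and the next one. The bound on `B` keeps both below the cap in `gridCell`. -/
theorem exists_gridCell {R μ : ℝ} {B : ℕ} (hB : ⌊R / 4⌋₊ + 1 ≤ B)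
    (hμ : μ ∈ Set.Icc (-R) R) :
    ∃ p q : Fin (B + 1), (∀ x, |x - μ| ≤ 4 → gridCell R B x = p ∨ gridCell R B x = q) ∧
      |gridPoint R p - μ| ≤ 12 ∧ |gridPoint R q - μ| ≤ 12 := by
  obtain ⟨h1, h2⟩ := hμ
  set a := ⌊(μ + R) / 8⌋₊ with ha
  have h0 : 0 ≤ (μ + R) / 8 := by linarith
  have ha1 : (a : ℝ) ≤ (μ + R) / 8 := Nat.floor_le h0
  have ha2 : (μ + R) / 8 < a + 1 := Nat.lt_floor_add_one _
  have haB : a + 1 ≤ B := by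
    have : a ≤ ⌊R / 4⌋₊ := Nat.floor_mono (by linarith)
    omega
  refine ⟨⟨a, by omega⟩, ⟨a + 1, by omega⟩, fun x hx => ?_, ?_, ?_⟩
  · obtain ⟨h3, h4⟩ := abs_le.1 hx
    have h5 : a ≤ ⌊(x + R + 4) / 8⌋₊ := Nat.floor_mono (by linarith)
    have h6 : ⌊(x + R + 4) / 8⌋₊ < a + 2 := by
      rw [Nat.floor_lt (by linarith)]
      push_cast
      linarith
    simp only [gridCell, Fin.mk.injEq]
    omega
  · simp only [gridPoint]
    rw [abs_le]
    constructor <;> linarith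
  · simp only [gridPoint]
    push_cast
    rw [abs_le]
    constructor <;> linarith

end Grid

/-! ### Accuracy of the two-stage estimator -/

section Estimator
variable {n B : ℕ} {R k α β A : ℝ}

/-- The mean of the data clipped around a given grid point, with additive noise of law `ν`. -/
noncomputable def refineKernel (n B : ℕ) (R T : ℝ) (ν : Measure ℝ) :
    Kernel ((Fin n → ℝ) × Fin (B + 1)) ℝ :=
  noiseKernel ν fun p => clippedMean T (gridPoint R p.1.2) p.1.1 + p.2

theorem measurable_refine (R T : ℝ) :
    Measurable fun p : ((Fin n → ℝ) × Fin (B + 1)) × ℝ =>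
      clippedMean T (gridPoint R p.1.2) p.1.1 + p.2 := by
  have h : Measurable fun p : (Fin n → ℝ) × Fin (B + 1) =>
      clippedMean T (gridPoint R p.2) p.1 :=
    measurable_from_prod_countable_left fun j => measurable_clippedMean T (gridPoint R j)
  exact (h.comp measurable_fst).add measurable_snd

instance refineKernel_isMarkov (R T : ℝ) (ν : Measure ℝ) [IsProbabilityMeasure ν] :
    IsMarkovKernel (refineKernel n B R T ν) :=
  noiseKernel_isMarkov ν (measurable_refine R T)

theorem refineKernel_apply (R T : ℝ) (ν : Measure ℝ) [IsProbabilityMeasure ν] (x : Fin n → ℝ)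
    (j : Fin (B + 1)) : refineKernel n B R T ν (x, j) =
      ν.map fun z => clippedMean T (gridPoint R j) x + z :=
  noiseKernel_apply ν (measurable_refine R T) (x, j)

theorem refineKernel_far_le {T : ℝ} {ν : Measure ℝ} [IsProbabilityMeasure ν] {x : Fin n → ℝ}
    {j : Fin (B + 1)} {μ : ℝ} (h : |clippedMean T (gridPoint R j) x - μ| ≤ α / 2) :
    refineKernel n B R T ν (x, j) {y | |μ - y| ≤ α}ᶜ ≤ ν {z | α / 2 < |z|} := by
  have hS : MeasurableSet {y : ℝ | |μ - y| ≤ α}ᶜ :=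
    (measurableSet_le (by fun_prop) measurable_const).compl
  rw [refineKernel_apply, Measure.map_apply (by fun_prop) hS]
  refine measure_mono fun z hz => ?_
  simp only [Set.mem_preimage, Set.mem_compl_iff, Set.mem_ofPred_eq, not_le] at hz ⊢
  have h1 := abs_add_le (μ - clippedMean T (gridPoint R j) x) (-z)
  rw [abs_neg, abs_sub_comm μ (clippedMean T (gridPoint R j) x),
    show μ - clippedMean T (gridPoint R j) x + -z =
      μ - (clippedMean T (gridPoint R j) x + z) by ring] at h1
  linarith

theorem cellCount_compl_le_and_exists {p q : Fin (B + 1)} {cell : ℝ → Fin (B + 1)} {μ : ℝ}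
    (hcell : ∀ t, |t - μ| ≤ 4 → cell t = p ∨ cell t = q) {x : Fin n → ℝ}
    (hx : ∑ i, (if |x i - μ| ≤ 4 then (0 : ℝ) else 1) ≤ n / 5) :
    ∑ j ∈ ({p, q} : Finset (Fin (B + 1)))ᶜ, cellCount cell x j ≤ n / 5 ∧
      ∃ g, 2 * n / 5 ≤ cellCount cell x g := by
  have h1 : ∑ j ∈ ({p, q} : Finset (Fin (B + 1)))ᶜ, cellCount cell x j ≤ n / 5 := by
    rw [sum_filter_cellCount]
    refine le_trans (Finset.sum_le_sum fun i _ => ?_) hx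
    by_cases hi : |x i - μ| ≤ 4
    · rw [if_pos hi, if_neg]
      simpa [or_iff_not_imp_left] using hcell _ hi
    · rw [if_neg hi]
      split_ifs <;> norm_num
  refine ⟨h1, ?_⟩
  have h2 : ∑ j, cellCount cell x j = n := by
    rw [sum_filter_cellCount]
    simp
  rw [← Finset.sum_add_sum_compl {p, q}] at h2
  by_contra! hne
  have h3 : ∑ j ∈ ({p, q} : Finset (Fin (B + 1))), cellCount cell x j ≤
      cellCount cell x p + cellCount cell x q := by
    by_cases hpq : p = q
    · subst hpq
      simp [cellCount_nonneg]
    · rw [Finset.sum_pair hpq]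
  linarith [hne p, hne q]

/-- The selected cell depends on the data, so the clipped mean cannot be analysed at it directly.
Off the event `E` the clipped means at both `p` and `q` are accurate and the counts separate good
cells from bad; only the internal randomness is left, with failure probability at most `η₁ + η₂`.
The factor 6 counts three two-sided tail bounds. -/
theorem estimatesMean_seqKernel (hB : ⌊R / 4⌋₊ + 1 ≤ B) (hk : 2 ≤ k) (hn : 0 < n)
    (hα : 0 < α) (hα1 : α < 1) (hA : 1 ≤ A) (hAα : A ^ (k - 1) = 1 / α) (hαA : α * A ≤ 1)
    {κ : Kernel (Fin n → ℝ) (Fin (B + 1))} [IsMarkovKernel κ] {ν : Measure ℝ}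
    [IsProbabilityMeasure ν] {η₁ η₂ : ℝ} (hη₁ : 0 ≤ η₁) (hη₂ : 0 ≤ η₂)
    (hκ : ∀ (x : Fin n → ℝ) (G : Finset (Fin (B + 1))),
      ∑ j ∈ Gᶜ, cellCount (gridCell R B) x j ≤ n / 5 →
      (∃ g, 2 * n / 5 ≤ cellCount (gridCell R B) x g) → κ x {j | j ∉ G} ≤ ENNReal.ofReal η₁)
    (hν : ν {z | α / 2 < |z|} ≤ ENNReal.ofReal η₂)
    (hβ : 6 * Real.exp (-(n * α ^ 2 / 4096)) + η₁ + η₂ ≤ β) :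
    EstimatesMean (seqKernel κ (refineKernel n B R (16 * A) ν)) k R α β := by
  intro D _ μ hμ hD
  obtain ⟨p, q, hpq, hp, hq⟩ := exists_gridCell hB hμ
  set P := Measure.pi fun _ : Fin n => D
  set S : Set ℝ := {y | |μ - y| ≤ α}
  have hS : MeasurableSet S := measurableSet_le (by fun_prop) measurable_const
  set E : Set (Fin n → ℝ) := {x | (n : ℝ) / 5 < ∑ i, if |x i - μ| ≤ 4 then (0 : ℝ) else 1} ∪
    ({x | α / 2 < |clippedMean (16 * A) (gridPoint R p) x - μ|} ∪
      {x | α / 2 < |clippedMean (16 * A) (gridPoint R q) x - μ|})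
  have hexp : Real.exp (-(n * α ^ 2 / 256)) ≤ Real.exp (-(n * α ^ 2 / 4096)) := by
    apply Real.exp_le_exp.2
    have : 0 ≤ n * α ^ 2 := by positivity
    linarith
  have hexp' : Real.exp (-(n / 4096)) ≤ Real.exp (-(n * α ^ 2 / 4096)) := by
    apply Real.exp_le_exp.2
    have h1 : α ^ 2 ≤ 1 := pow_le_one₀ hα.le hα1.le
    have h2 : n * α ^ 2 ≤ n * 1 := by gcongr
    linarith
  have hE : P E ≤ ENNReal.ofReal (6 * Real.exp (-(n * α ^ 2 / 4096))) := by
    calc P E ≤ _ := (measure_union_le _ _).trans (add_le_add le_rfl (measure_union_le _ _))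
      _ ≤ _ := add_le_add (hD.measure_far_le hk n) (add_le_add
          (hD.measure_clippedMean_le hk hn hα hA hAα hαA hp)
          (hD.measure_clippedMean_le hk hn hα hA hAα hαA hq))
      _ = ENNReal.ofReal (2 * Real.exp (-(n / 4096)) + (2 * Real.exp (-(n * α ^ 2 / 256)) +
            2 * Real.exp (-(n * α ^ 2 / 256)))) := by
          rw [ENNReal.ofReal_add (by positivity) (by positivity),
            ENNReal.ofReal_add (by positivity) (by positivity)]
      _ ≤ _ := by
          apply ENNReal.ofReal_le_ofReal
          linarith
  set M := seqKernel κ (refineKernel n B R (16 * A) ν)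
  -- A measurable hull of `E` has the same measure, so measurability of `E` itself is not needed.
  have hM : ∀ x, M x Sᶜ ≤ (toMeasurable P E).indicator 1 x + ENNReal.ofReal (η₁ + η₂) := by
    intro x
    by_cases hx : x ∈ toMeasurable P E
    · rw [Set.indicator_of_mem hx]
      exact le_add_right (by simpa using prob_le_one)
    rw [Set.indicator_of_notMem hx, zero_add]
    have hxE : x ∉ E := fun h => hx (subset_toMeasurable P E h)
    simp only [E, Set.mem_union, Set.mem_ofPred_eq, not_or, not_lt] at hxE
    obtain ⟨h1, h2, h3⟩ := hxE
    obtain ⟨h4, h5⟩ := cellCount_compl_le_and_exists hpq h1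
    have h6 := hκ x {p, q} h4 h5
    calc M x Sᶜ = ∫⁻ j, refineKernel n B R (16 * A) ν (x, j) Sᶜ ∂(κ x) :=
          seqKernel_apply _ _ _ hS.compl
      _ ≤ ∫⁻ j, ({j | j ∉ ({p, q} : Finset (Fin (B + 1)))}.indicator 1 j +
            ENNReal.ofReal η₂) ∂(κ x) := by
          refine lintegral_mono fun j => ?_
          by_cases hj : j ∈ ({p, q} : Finset (Fin (B + 1)))
          · refine le_add_left (le_trans (refineKernel_far_le ?_) hν)
            rcases (by simpa using hj : j = p ∨ j = q) with rfl | rfl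
            · exact h2
            · exact h3
          · rw [Set.indicator_of_mem (by exact hj)]
            exact le_add_right (by simpa using prob_le_one)
      _ = κ x {j | j ∉ ({p, q} : Finset (Fin (B + 1)))} + ENNReal.ofReal η₂ := by
          rw [lintegral_add_right _ measurable_const,
            lintegral_indicator_one MeasurableSet.of_discrete]
          simp
      _ ≤ _ := by
          rw [ENNReal.ofReal_add hη₁ hη₂]
          gcongr
  have hbad : (M ∘ₘ P) Sᶜ ≤ ENNReal.ofReal β := by
    rw [Measure.bind_apply hS.compl M.aemeasurable]
    calc ∫⁻ x, M x Sᶜ ∂P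
        ≤ ∫⁻ x, ((toMeasurable P E).indicator 1 x + ENNReal.ofReal (η₁ + η₂)) ∂P :=
          lintegral_mono hM
      _ = P E + ENNReal.ofReal (η₁ + η₂) := by
          rw [lintegral_add_right _ measurable_const,
            lintegral_indicator_one (measurableSet_toMeasurable _ _), measure_toMeasurable]
          simp
      _ ≤ ENNReal.ofReal (6 * Real.exp (-(n * α ^ 2 / 4096))) + ENNReal.ofReal (η₁ + η₂) := by
          gcongr
      _ ≤ _ := by
          rw [← ENNReal.ofReal_add (by positivity) (by positivity)]
          apply ENNReal.ofReal_le_ofReal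
          linarith
  have hβ0 : 0 ≤ β := by
    have := Real.exp_pos (-(n * α ^ 2 / 4096))
    linarith
  rw [ENNReal.ofReal_sub _ hβ0, ENNReal.ofReal_one, tsub_le_iff_right]
  calc (1 : ℝ≥0∞) = (M ∘ₘ P) S + (M ∘ₘ P) Sᶜ := (prob_add_prob_compl hS).symm
    _ ≤ _ := by gcongr

end Estimator

/-! ### The two private mechanisms -/

section Mechanisms
variable {n : ℕ} {R k α β A Λ : ℝ}

theorem exists_isDP_estimatesMean (hk : 2 ≤ k) (hn : 5 ≤ n) (hα : 0 < α)
    (hα1 : α < 1) (hA : 1 ≤ A) (hAα : A ^ (k - 1) = 1 / α) (hαA : α * A ≤ 1)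
    (hΛ : Real.exp (-Λ) ≤ β / 40) {ε δ : ℝ} (hε : 0 < ε) (hδ : 0 < δ) (hδ1 : δ < 1)
    (h₁ : Λ ≤ n * α ^ 2 / 4096) (h₂ : Λ + Real.log (1 / δ) ≤ ε * n / 20)
    (h₃ : Λ ≤ n * ε * α / (256 * A)) :
    ∃ M : Kernel (Fin n → ℝ) ℝ, IsMarkovKernel M ∧ IsDP M ε δ ∧ EstimatesMean M k R α β := by
  have hn' : (0 : ℝ) < n := by exact_mod_cast (by omega : 0 < n)
  have hA0 : 0 < A := by linarith
  set B := ⌊R / 4⌋₊ + 1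
  -- The sensitivity `32 * A / n` equals `(ε / 2) * b`. The histogram is run with `ε / 4` and uses
  -- the other half of the budget.
  set b := 64 * A / (n * ε) with hb
  have hb0 : 0 < b := by positivity
  have hcell := measurable_gridCell R B
  have hε4 : 0 < ε / 4 := by linarith
  have := stableHistogram_isMarkov (n := n) hcell 0 hε4 hδ hδ1
  have := isProbabilityMeasure_laplaceMeasure hb0
  refine ⟨seqKernel (stableHistogram n (gridCell R B) 0 (ε / 4) δ)
    (refineKernel n B R (16 * A) (laplaceMeasure b)), inferInstance, ?_, ?_⟩
  · intro x x' hxx S hS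
    have hfine : ∀ j, DPDominated (ENNReal.ofReal (Real.exp (ε / 2))) 0
        (refineKernel n B R (16 * A) (laplaceMeasure b) (x, j))
        (refineKernel n B R (16 * A) (laplaceMeasure b) (x', j)) := by
      intro j
      rw [refineKernel_apply, refineKernel_apply]
      refine dpDominated_laplace hb0
        ((hxx.abs_clippedMean_sub_le (by positivity) _).trans_eq ?_)
      rw [hb]
      field_simp
      ring
    have := ((hxx.dpDominated_stableHistogram hcell 0 hε4 hδ hδ1).seqKernel hfine).measure_le hS
    rwa [← ENNReal.ofReal_mul (Real.exp_nonneg _), ← Real.exp_add,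
      show 2 * (ε / 4) + ε / 2 = ε by ring] at this
  · refine estimatesMean_seqKernel le_rfl hk (by omega) hα hα1 hA hAα hαA
      (η₁ := 2 / δ * Real.exp (-(ε / 4 * n / 5))) (η₂ := 2 * Real.exp (-(α / 2 / (2 * b))))
      (by positivity) (by positivity)
      (fun x G hbad hgood => stableHistogram_compl_le hcell 0 hε4 hδ hδ1 hn hbad hgood)
      (laplaceMeasure_abs_gt_le hb0) ?_
    have e1 : Real.exp (-(n * α ^ 2 / 4096)) ≤ Real.exp (-Λ) := Real.exp_le_exp.2 (by linarith)
    have e2 : 2 / δ * Real.exp (-(ε / 4 * n / 5)) ≤ 2 * Real.exp (-Λ) := by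
      calc 2 / δ * Real.exp (-(ε / 4 * n / 5))
          ≤ 2 / δ * Real.exp (-Λ + -Real.log (1 / δ)) := by
            gcongr
            linarith
        _ = 2 * Real.exp (-Λ) := by
            rw [Real.exp_add, one_div, Real.log_inv, neg_neg, Real.exp_log hδ]
            field_simp
    have e3 : Real.exp (-(α / 2 / (2 * b))) ≤ Real.exp (-Λ) := by
      apply Real.exp_le_exp.2
      have : α / 2 / (2 * b) = n * ε * α / (256 * A) := by
        rw [hb]
        field_simp
        ring
      linarith
    have e4 := Real.exp_pos (-Λ)
    linarith

theorem exists_isZCDP_estimatesMean (hk : 2 ≤ k) (hR : 1 < R) (hn : 0 < n) (hα : 0 < α)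
    (hα1 : α < 1) (hA : 1 ≤ A) (hAα : A ^ (k - 1) = 1 / α) (hαA : α * A ≤ 1)
    (hΛ : Real.exp (-Λ) ≤ β / 40) {ρ : ℝ} (hρ : 0 < ρ)
    (h₁ : Λ ≤ n * α ^ 2 / 4096) (h₂ : Λ + Real.log R ≤ n ^ 2 * ρ / 400)
    (h₃ : Λ ≤ n ^ 2 * ρ * α ^ 2 / (8192 * A ^ 2)) :
    ∃ M : Kernel (Fin n → ℝ) ℝ, IsMarkovKernel M ∧ IsZCDP M ρ ∧ EstimatesMean M k R α β := by
  have hn' : (0 : ℝ) < n := by exact_mod_cast hn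
  have hA0 : 0 < A := by linarith
  set B := ⌊R / 4⌋₊ + 1 with hB
  have hcell := measurable_gridCell R B
  -- Each variance spends `ρ / 2`: the histogram costs `1 / v₁`, and the mean, of sensitivity `32 *
  -- A / n`, costs `(32 * A / n) ^ 2 / (2 * v₂)`.
  set v₁ : NNReal := Real.toNNReal (2 / ρ) with hv₁
  set v₂ : NNReal := Real.toNNReal ((32 * A / n) ^ 2 / ρ) with hv₂
  have hv₁c : (v₁ : ℝ) = 2 / ρ := Real.coe_toNNReal _ (by positivity)
  have hv₂c : (v₂ : ℝ) = (32 * A / n) ^ 2 / ρ := Real.coe_toNNReal _ (by positivity)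
  have hv₁0 : v₁ ≠ 0 := (Real.toNNReal_pos.2 (by positivity)).ne'
  have hv₂0 : v₂ ≠ 0 := (Real.toNNReal_pos.2 (by positivity)).ne'
  have := noisyHistogram_isMarkov (n := n) hcell v₁
  refine ⟨seqKernel (noisyHistogram n (gridCell R B) v₁)
    (refineKernel n B R (16 * A) (gaussianReal 0 v₂)), inferInstance, ?_, ?_⟩
  · intro x x' hxx a ha
    have hfine : ∀ j, RenyiDominated a (ρ / 2)
        (refineKernel n B R (16 * A) (gaussianReal 0 v₂) (x, j))
        (refineKernel n B R (16 * A) (gaussianReal 0 v₂) (x', j)) := by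
      intro j
      rw [refineKernel_apply, refineKernel_apply, gaussianReal_map_const_add,
        gaussianReal_map_const_add, zero_add, zero_add]
      refine (renyiDominated_gaussianReal hv₂0 ha).mono ha ?_
      have h1 := hxx.abs_clippedMean_sub_le (T := 16 * A) (by positivity) (gridPoint R j)
      have h2 : (clippedMean (16 * A) (gridPoint R j) x -
          clippedMean (16 * A) (gridPoint R j) x') ^ 2 ≤ (32 * A / n) ^ 2 := by
        rw [← sq_abs]
        refine pow_le_pow_left₀ (abs_nonneg _) (h1.trans_eq ?_) 2
        ring
      rw [hv₂c, div_le_iff₀ (by positivity)]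
      refine h2.trans_eq ?_
      field_simp
    have := ((hxx.renyiDominated_noisyHistogram hcell hv₁0 ha).seqKernel ha hfine).renyiDiv_le ha
    rwa [hv₁c, show 1 / (2 / ρ) + ρ / 2 = ρ by field_simp; ring] at this
  · have hsub : {z : ℝ | α / 2 < |z|} ⊆ {z | α / 2 ≤ |z|} :=
      fun z (hz : α / 2 < |z|) => hz.le
    refine estimatesMean_seqKernel le_rfl hk hn hα hα1 hA hAα hαA
      (η₁ := (B + 1) * (2 * Real.exp (-((n / 10) ^ 2 / (2 * v₁)))))
      (η₂ := 2 * Real.exp (-((α / 2) ^ 2 / (2 * v₂))))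
      (by positivity) (by positivity)
      (fun x G hbad hgood => noisyHistogram_compl_le hcell hv₁0 hbad hgood)
      ((measure_mono hsub).trans (gaussianReal_abs_ge_le hv₂0 (by positivity))) ?_
    have e1 : Real.exp (-(n * α ^ 2 / 4096)) ≤ Real.exp (-Λ) := Real.exp_le_exp.2 (by linarith)
    have hBR : (B : ℝ) + 1 ≤ 3 * R := by
      have := Nat.floor_le (show 0 ≤ R / 4 by linarith)
      rw [hB]
      push_cast
      linarith
    have e2 : (B + 1) * (2 * Real.exp (-((n / 10) ^ 2 / (2 * v₁)))) ≤ 6 * Real.exp (-Λ) := by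
      have hexp : (n / 10 : ℝ) ^ 2 / (2 * v₁) = n ^ 2 * ρ / 400 := by
        rw [hv₁c]
        field_simp
        ring
      calc (B + 1) * (2 * Real.exp (-((n / 10) ^ 2 / (2 * v₁))))
          ≤ (3 * R) * (2 * Real.exp (-Λ + -Real.log R)) := by
            gcongr
            linarith
        _ = 6 * Real.exp (-Λ) := by
            rw [Real.exp_add, Real.exp_neg (Real.log R), Real.exp_log (by linarith)]
            field_simp
            ring
    have e3 : Real.exp (-((α / 2) ^ 2 / (2 * v₂))) ≤ Real.exp (-Λ) := by
      apply Real.exp_le_exp.2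
      have : (α / 2) ^ 2 / (2 * v₂) = n ^ 2 * ρ * α ^ 2 / (8192 * A ^ 2) := by
        rw [hv₂c]
        field_simp
        ring
      linarith
    have e4 := Real.exp_pos (-Λ)
    linarith

end Mechanisms

/-! ### Sample size arithmetic and the main theorem -/

/-- The choice is `A = α ^ (-1 / (k - 1))`; `α * A ≤ 1` holds because `1 / (k - 1) ≤ 1`. -/
theorem exists_clipping_scale {k α : ℝ} (hk : 2 ≤ k) (hα : 0 < α) (hα1 : α < 1) :
    ∃ A : ℝ, 1 ≤ A ∧ A ^ (k - 1) = 1 / α ∧ α * A ≤ 1 ∧ α ^ (k / (k - 1)) = α / A := by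
  have hk1 : 0 < k - 1 := by linarith
  refine ⟨α ^ (-(1 / (k - 1))), ?_, ?_, ?_, ?_⟩
  · exact Real.one_le_rpow_of_pos_of_le_one_of_nonpos hα hα1.le
      (neg_nonpos.2 (by positivity))
  · rw [← Real.rpow_mul hα.le, show -(1 / (k - 1)) * (k - 1) = -1 by field_simp,
      Real.rpow_neg_one, one_div]
  · have h1 : α * α ^ (-(1 / (k - 1))) = α ^ (1 + -(1 / (k - 1))) := by
      rw [Real.rpow_add hα, Real.rpow_one]
    rw [h1]
    refine Real.rpow_le_one hα.le hα1.le ?_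
    have : 1 / (k - 1) ≤ 1 := by
      rw [div_le_one hk1]; linarith
    linarith
  · rw [Real.rpow_neg hα.le, div_inv_eq_mul]
    nth_rewrite 2 [← Real.rpow_one α]
    rw [← Real.rpow_add hα]
    congr 1
    field_simp
    ring

/-- The common form of the two sample size conditions. -/
theorem sample_size_bounds {C L Λ α A s t : ℝ} {n : ℕ} (hC : 0 < C) (hL : 0 < L) (hα : 0 < α)
    (hA : 0 < A) (hs : 0 < s) (ht : 0 ≤ t) (hΛ : Λ ≤ C * L)
    (h : 10000 * C * (L / α ^ 2 + L / (s * (α / A)) + t * L / s) ≤ n) :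
    10000 * Λ ≤ n * α ^ 2 ∧ 10000 * (Λ * (A / α) + t * Λ) ≤ n * s := by
  have h1 : 0 ≤ L / (s * (α / A)) := by positivity
  have h2 : 0 ≤ t * L / s := by positivity
  have h3 : 0 ≤ L / α ^ 2 := by positivity
  constructor
  · have h4 : 10000 * C * (L / α ^ 2) ≤ n :=
      (mul_le_mul_of_nonneg_left (by linarith) (by positivity)).trans h
    calc 10000 * Λ ≤ 10000 * (C * L) := by gcongr
      _ = 10000 * C * (L / α ^ 2) * α ^ 2 := by field_simp
      _ ≤ _ := by gcongr
  · have h4 : 10000 * C * (L / (s * (α / A)) + t * L / s) ≤ n :=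
      (mul_le_mul_of_nonneg_left (by linarith) (by positivity)).trans h
    calc 10000 * (Λ * (A / α) + t * Λ)
        ≤ 10000 * (C * L * (A / α) + t * (C * L)) := by gcongr
      _ = 10000 * C * (L / (s * (α / A)) + t * L / s) * s := by field_simp
      _ ≤ _ := by gcongr

theorem mainTheorem6 :
    ∀ β₀ : ℝ, β₀ < 1 → ∃ C : ℝ, 0 < C ∧
      ∀ k R α β : ℝ, 2 ≤ k → 1 < R → 0 < α → α < 1 → 0 < β → β ≤ β₀ →
        (∀ ε δ : ℝ, 0 < ε → 0 < δ → δ < 1 → ∀ n : ℕ,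
          C * (Real.log (1 / β) / α ^ 2 +
              Real.log (1 / β) / (ε * α ^ (k / (k - 1))) +
              Real.log (1 / δ) * Real.log (1 / β) / ε) ≤ (n : ℝ) →
          ∃ M : Kernel (Fin n → ℝ) ℝ, IsMarkovKernel M ∧
            IsDP M ε δ ∧ EstimatesMean M k R α β) ∧
        (∀ ρ : ℝ, 0 < ρ → ∀ n : ℕ,
          C * (Real.log (1 / β) / α ^ 2 +
              Real.log (1 / β) / (Real.sqrt ρ * α ^ (k / (k - 1))) +
              Real.sqrt (Real.log R) * Real.log (1 / β) / Real.sqrt ρ) ≤ (n : ℝ) →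
          ∃ M : Kernel (Fin n → ℝ) ℝ, IsMarkovKernel M ∧
            IsZCDP M ρ ∧ EstimatesMean M k R α β) := by
  intro β₀ hβ₀
  rcases le_or_gt β₀ 0 with h0 | h0
  · exact ⟨1, one_pos, fun k R α β _ _ _ _ hβ hβ' => absurd hβ' (by linarith)⟩
  have hℓ : 0 < Real.log (1 / β₀) := Real.log_pos (by rw [lt_div_iff₀ h0]; linarith)
  set ℓ := Real.log (1 / β₀)
  -- Since `β ≤ β₀` keeps `log (1 / β)` at least `ℓ > 0`, the constant `log 40` in `Λ` is absorbed
  -- into a multiple of `log (1 / β)`. This is where `C` depends on `β₀`.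
  set C₀ := 1 + Real.log 40 / ℓ with hC₀
  have hlog40 : 1 ≤ Real.log 40 := by
    rw [Real.le_log_iff_exp_le (by norm_num)]
    linarith [Real.exp_one_lt_d9]
  have hC₀pos : 0 < C₀ := by positivity
  refine ⟨10000 * C₀, by positivity, fun k R α β hk hR hα hα1 hβ hββ => ?_⟩
  have hL : ℓ ≤ Real.log (1 / β) := Real.log_le_log (by positivity) (by gcongr)
  set L := Real.log (1 / β) with hLdef
  -- Then `exp (-Λ) = β / 40`, and the failure bounds sum to at most `10 * exp (-Λ)` in (a) and `14
  -- * exp (-Λ)` in (b).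
  set Λ := Real.log 40 + L with hΛdef
  have hΛL : Λ ≤ C₀ * L := by
    have : Real.log 40 = Real.log 40 / ℓ * ℓ := by field_simp
    have h2 : Real.log 40 / ℓ * ℓ ≤ Real.log 40 / ℓ * L := by gcongr
    rw [hC₀, hΛdef]
    linarith
  have hΛ1 : 1 ≤ Λ := by linarith
  have hΛβ : Real.exp (-Λ) ≤ β / 40 := by
    rw [hΛdef, neg_add, Real.exp_add, Real.exp_neg, Real.exp_log (by norm_num), hLdef, one_div,
      Real.log_inv, neg_neg, Real.exp_log hβ]
    linarith
  obtain ⟨A, hA, hAα, hαA, hpow⟩ := exists_clipping_scale hk hα hα1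
  have hA0 : 0 < A := by linarith
  have hL0 : 0 < L := by linarith
  have hαle : 1 ≤ A / α := by
    rw [le_div_iff₀ hα]; linarith
  rw [hpow]
  have hsize := fun (s t : ℝ) (n : ℕ) (hs : 0 < s) (ht : 0 ≤ t) =>
    sample_size_bounds (n := n) hC₀pos hL0 hα hA0 hs ht hΛL
  have hnle : ∀ n : ℕ, 10000 * Λ ≤ n * α ^ 2 → 5 ≤ n := by
    intro n h
    have h1 : n * α ^ 2 ≤ n * 1 := by
      gcongr
      exact pow_le_one₀ hα.le hα1.le
    have : (5 : ℝ) ≤ n := by linarith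
    exact_mod_cast this
  have hΛA : Λ ≤ Λ * (A / α) := le_mul_of_one_le_right (by linarith) hαle
  constructor
  · intro ε δ hε hδ hδ1 n hn
    have hlogδ : 0 ≤ Real.log (1 / δ) := Real.log_nonneg (by rw [le_div_iff₀ hδ]; linarith)
    obtain ⟨h1, h2⟩ := hsize ε _ n hε hlogδ hn
    have ht : Real.log (1 / δ) ≤ Real.log (1 / δ) * Λ := le_mul_of_one_le_right hlogδ hΛ1
    refine exists_isDP_estimatesMean hk (hnle n h1) hα hα1 hA hAα hαA hΛβ hε hδ hδ1
      (by linarith) (by linarith) ?_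
    have h3 : 10000 * (Λ * (A / α)) ≤ n * ε := by
      have : 0 ≤ Real.log (1 / δ) * Λ := by positivity
      linarith
    rw [le_div_iff₀ (by positivity)]
    calc Λ * (256 * A) ≤ 10000 * (Λ * (A / α)) * α := by
          rw [show 10000 * (Λ * (A / α)) * α = Λ * (10000 * A) by field_simp]
          gcongr
          norm_num
      _ ≤ _ := by gcongr
  · intro ρ hρ n hn
    have hs : 0 < Real.sqrt ρ := Real.sqrt_pos.2 hρ
    have hlogR : 0 ≤ Real.log R := Real.log_nonneg hR.le
    obtain ⟨h1, h2⟩ := hsize (Real.sqrt ρ) _ n hs (Real.sqrt_nonneg (Real.log R)) hn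
    have hn0 : 0 < n := by have := hnle n h1; omega
    set t := Real.sqrt (Real.log R) with htdef
    have ht0 : 0 ≤ t := Real.sqrt_nonneg _
    have ht2 : t ^ 2 = Real.log R := Real.sq_sqrt hlogR
    have ht : t ≤ t * Λ := le_mul_of_one_le_right ht0 hΛ1
    have hsq : n ^ 2 * ρ = (n * Real.sqrt ρ) ^ 2 := by
      rw [mul_pow, Real.sq_sqrt hρ.le]
    -- Gaussian tails require `n ^ 2 * ρ` to be only linear in `Λ`, while squaring the sample size
    -- condition yields `Λ ^ 2`; `1 ≤ Λ` bridges the two.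
    have hΛ2 : Λ ≤ Λ ^ 2 := by nlinarith
    refine exists_isZCDP_estimatesMean hk hR hn0 hα hα1 hA hAα hαA hΛβ hρ
      (by linarith) ?_ ?_
    · have h3 : 10000 * (Λ + t) ≤ n * Real.sqrt ρ := by linarith
      have h4 : (10000 * (Λ + t)) ^ 2 ≤ (n * Real.sqrt ρ) ^ 2 := by gcongr
      rw [hsq, ← ht2]
      nlinarith [mul_nonneg (by linarith : 0 ≤ Λ) ht0]
    · have h3 : 10000 * (Λ * (A / α)) ≤ n * Real.sqrt ρ := by
        have : 0 ≤ t * Λ := by positivity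
        linarith
      have h4 : (10000 * (Λ * (A / α))) ^ 2 ≤ (n * Real.sqrt ρ) ^ 2 := by gcongr
      rw [hsq, le_div_iff₀ (by positivity)]
      calc Λ * (8192 * A ^ 2) ≤ Λ ^ 2 * (10000 ^ 2 * A ^ 2) := by
            gcongr
            norm_num
        _ = (10000 * (Λ * (A / α))) ^ 2 * α ^ 2 := by
            field_simp
        _ ≤ _ := by gcongr
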